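/- Let $K$ be a field of characteristic $0$ and let $l\ge 1$ be an integer. Let $A_1^{(l)}$ be the Ore extension $K[Z,Z^{-1}][Y;\mathrm{id},\delta]$, where $\delta$ is the $K$-derivation with $\delta(Z)=\frac1l Z^{1-l}$; that is, $Ya=aY+\delta(a)$ for $a\in K[Z,Z^{-1}]$. Write $X^{i/l}:=Z^i$, so that $[Y,X]=1$, and let $A_1\subseteq A_1^{(l)}$ be the subalgebra generated by $X$ and $Y$ (the Weyl algebra). Let $L^{(l)}=K[x^{1/l},x^{-1/l},y]$ (commutative) and let $\Psi\colon A_1^{(l)}\to L^{(l)}$ be the $K$-linear bijection $X^{i/l}Y^j\mapsto x^{i/l}y^j$. A direction is a pair $(\rho,\sigma)$ of coprime integers with $\rho+\sigma>0$. For $p=\sum a_{i,j}x^{i/l}y^j\in L^{(l)}$ and integers $\rho,\sigma$ let $\mathrm{Supp}(p)=\{(i/l,j):a_{i,j}\ne0\}$, let $v_{\rho,\sigma}(p)=\max\{\rho a+\sigma b:(a,b)\in\mathrm{Supp}(p)\}$ (with $v_{\rho,\sigma}(0)=-\infty$), and let $\ell_{\rho,\sigma}(p)$ be the sum of the terms of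 $p$ of maximal degree $\rho\frac il+\sigma j=v_{\rho,\sigma}(p)$. Call $p$ $(\rho,\sigma)$-homogeneous if $p=0$ or $p=\ell_{\rho,\sigma}(p)$. For $p\ne0$ let $w(p)$ be the point of $\mathrm{Supp}(\ell_{1,-1}(p))$ with the largest first coordinate, and $\overline w(p)$ the point of $\mathrm{Supp}(\ell_{-1,1}(p))$ with the largest second coordinate. For $P\in A_1^{(l)}$ put $v_{\rho,\sigma}(P)=v_{\rho,\sigma}(\Psi(P))$, $\ell_{\rho,\sigma}(P)=\ell_{\rho,\sigma}(\Psi(P))\in L^{(l)}$, call $P$ $(\rho,\sigma)$-homogeneous if $\Psi(P)$ is, and for $P\neq 0$ put $\mathrm{st}_{\rho,\sigma}(P)=w(\ell_{\rho,\sigma}(P))$ and $\mathrm{en}_{\rho,\sigma}(P)=\overline w(\ell_{\rho,\sigma}(P))$. For nonzero $P,Q\in A_1^{(l)}$ let $$[P,Q]_{\rho,\sigma}=\begin{cases}0&\text{if } v_{\rho,\sigma}([P,Q])<v_{\rho,\sigma}(P)+v_{\rho,\sigma}(Q)-(\rho+\sigma),\\ \ell_{\rho,\sigma}([P,Q])&\text{otherwise.}\end{cases}$$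 Points $A,B$ of the plane are aligned, $A\sim B$, if $\det\binom{A}{B}=0$. Theorem. Let $P,Q\in A_1^{(l)}$ with $[Q,P]=1$ and let $(\rho,\sigma)$ be a direction with $v_{\rho,\sigma}(P)>0$. Then there is a $(\rho,\sigma)$-homogeneous $F\in A_1^{(l)}$ with $v_{\rho,\sigma}(F)=\rho+\sigma$ and $[P,F]_{\rho,\sigma}=\ell_{\rho,\sigma}(P)$ such that: 1. $\mathrm{st}_{\rho,\sigma}(P)\sim\mathrm{st}_{\rho,\sigma}(F)$ or $\mathrm{st}_{\rho,\sigma}(F)=(1,1)$; 2. $\mathrm{en}_{\rho,\sigma}(P)\sim\mathrm{en}_{\rho,\sigma}(F)$ or $\mathrm{en}_{\rho,\sigma}(F)=(1,1)$. Moreover: 3. $\mathrm{st}_{\rho,\sigma}(P)\nsim(1,1)\nsim\mathrm{en}_{\rho,\sigma}(P)$; 4. if $P,Q\in A_1$, then $F$ can be taken in $A_1$. -/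

import Mathlib

open Polynomial

/-! ## Ore extensions `A[Y; id, δ]` of a commutative algebra by a derivation -/

section Ore

variable {K A : Type*} [CommRing K] [CommRing A] [Algebra K A]

/-- The Ore extension `A[Y; id, δ]`: the free left `A`-module on the powers of `Y`, with the
associative multiplication determined by `Y * a = a * Y + δ a`. An element `∑ aⱼ Yʲ` (coefficients
on the left) is stored as the polynomial with coefficients `aⱼ`. -/
def OreExtension (_δ : Derivation K A A) : Type _ := A[X]

namespace OreExtension

noncomputable instance (δ : Derivation K A A) : AddCommGroup (OreExtension δ) :=
  inferInstanceAs (AddCommGroup A[X])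

noncomputable instance (δ : Derivation K A A) : Module K (OreExtension δ) :=
  inferInstanceAs (Module K A[X])

/-- The linear identification `∑ aⱼ Yʲ ↦ ∑ aⱼ yʲ` with the commutative polynomial ring. -/
noncomputable def toPoly (δ : Derivation K A A) : OreExtension δ ≃ₗ[K] A[X] :=
  LinearEquiv.refl K A[X]

/-- Left multiplication by `Y`: `b Yʲ ↦ b Yʲ⁺¹ + δ(b) Yʲ`. -/
noncomputable def mulY (δ : Derivation K A A) : A[X] →ₗ[K] A[X] :=
  Polynomial.lsum fun j =>
    (Polynomial.monomial (j + 1)).restrictScalars K +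
      (Polynomial.monomial j).restrictScalars K ∘ₗ (δ : A →ₗ[K] A)

/-- Left multiplication: `∑ aᵢ Yⁱ` acts as `∑ aᵢ • (mulY δ)ⁱ`. -/
noncomputable def leftMul (δ : Derivation K A A) : A[X] →ₗ[K] Module.End K A[X] :=
  Polynomial.lsum fun i =>
    LinearMap.mulRight K (mulY δ ^ i) ∘ₗ
      (Algebra.lmul K A[X]).toLinearMap ∘ₗ (CAlgHom : A →ₐ[K] A[X]).toLinearMap

theorem mulY_monomial (δ : Derivation K A A) (j : ℕ) (b : A) :
    mulY δ (monomial j b) = monomial (j + 1) b + monomial j (δ b) := by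
  simp [mulY, Polynomial.lsum_apply, Polynomial.sum_monomial_index]

theorem mulY_C_mul (δ : Derivation K A A) (a : A) (p : A[X]) :
    mulY δ (C a * p) = C a * mulY δ p + C (δ a) * p := by
  induction p using Polynomial.induction_on' with
  | add p q hp hq => simp only [mul_add, map_add, hp, hq]; ring
  | monomial j b =>
    simp only [C_mul_monomial, mulY_monomial, mul_add, Derivation.leibniz, map_add, smul_eq_mul]
    rw [mul_comm b (δ a)]; ring

theorem leftMul_monomial (δ : Derivation K A A) (i : ℕ) (a : A) (q : A[X]) :
    leftMul δ (monomial i a) q = C a * (mulY δ ^ i) q := by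
  simp [leftMul, Polynomial.lsum_apply, Polynomial.sum_monomial_index]

theorem mulY_pow_one (δ : Derivation K A A) (i : ℕ) : (mulY δ ^ i) (1 : A[X]) = X ^ i := by
  induction i with
  | zero => simp
  | succ i ih =>
    rw [pow_succ', Module.End.mul_apply, ih, X_pow_eq_monomial, mulY_monomial]
    simp [X_pow_eq_monomial]

theorem leftMul_apply_one (δ : Derivation K A A) (p : A[X]) : leftMul δ p 1 = p := by
  induction p using Polynomial.induction_on' with
  | add p q hp hq => simp [hp, hq]
  | monomial i a => rw [leftMul_monomial, mulY_pow_one, C_mul_X_pow_eq_monomial]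

theorem leftMul_one (δ : Derivation K A A) : leftMul δ 1 = 1 := by
  ext1 q
  rw [← monomial_zero_one, leftMul_monomial]; simp

theorem leftMul_C_mul (δ : Derivation K A A) (a : A) (p q : A[X]) :
    leftMul δ (C a * p) q = C a * leftMul δ p q := by
  induction p using Polynomial.induction_on' with
  | add p p' hp hp' => simp only [mul_add, map_add, LinearMap.add_apply, hp, hp']
  | monomial i b => rw [C_mul_monomial, leftMul_monomial, leftMul_monomial, C_mul, mul_assoc]

theorem leftMul_mulY (δ : Derivation K A A) (p q : A[X]) :
    leftMul δ (mulY δ p) q = mulY δ (leftMul δ p q) := by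
  induction p using Polynomial.induction_on' with
  | add p p' hp hp' => simp only [map_add, LinearMap.add_apply, hp, hp']
  | monomial i b =>
    rw [mulY_monomial, map_add, LinearMap.add_apply, leftMul_monomial, leftMul_monomial,
      leftMul_monomial, mulY_C_mul, pow_succ', Module.End.mul_apply]

theorem leftMul_mulY_pow (δ : Derivation K A A) (i : ℕ) (p q : A[X]) :
    leftMul δ ((mulY δ ^ i) p) q = (mulY δ ^ i) (leftMul δ p q) := by
  induction i with
  | zero => simp
  | succ i ih => rw [pow_succ', Module.End.mul_apply, leftMul_mulY, ih, Module.End.mul_apply]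

theorem leftMul_assoc (δ : Derivation K A A) (p q r : A[X]) :
    leftMul δ (leftMul δ p q) r = leftMul δ p (leftMul δ q r) := by
  induction p using Polynomial.induction_on' with
  | add p p' hp hp' => simp only [map_add, LinearMap.add_apply, hp, hp']
  | monomial i a =>
    rw [leftMul_monomial, leftMul_monomial, leftMul_C_mul, leftMul_mulY_pow]

noncomputable instance (δ : Derivation K A A) : Ring (OreExtension δ) where
  __ := (inferInstance : AddCommGroup (OreExtension δ))
  mul p q := leftMul δ p q
  one := (1 : A[X])
  mul_assoc p q r := leftMul_assoc δ p q r
  one_mul p := LinearMap.congr_fun (leftMul_one δ) p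
  mul_one p := leftMul_apply_one δ p
  left_distrib p q r := map_add (leftMul δ p) q r
  right_distrib p q r := LinearMap.congr_fun (map_add (leftMul δ) p q) r
  zero_mul p := LinearMap.congr_fun (map_zero (leftMul δ)) p
  mul_zero p := map_zero (leftMul δ p)

noncomputable instance (δ : Derivation K A A) : Algebra K (OreExtension δ) :=
  Algebra.ofModule
    (fun r p q => LinearMap.congr_fun (map_smul (leftMul δ) r p) q)
    (fun r p q => map_smul (leftMul δ p) r q)

/-- The element `a` of the coefficient ring, in `A[Y; id, δ]`. -/
noncomputable def coef (δ : Derivation K A A) (a : A) : OreExtension δ :=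
  (toPoly δ).symm (C a)

/-- The variable `Y` of `A[Y; id, δ]`. -/
noncomputable def varY (δ : Derivation K A A) : OreExtension δ :=
  (toPoly δ).symm X

theorem toPoly_mul (δ : Derivation K A A) (p q : OreExtension δ) :
    toPoly δ (p * q) = leftMul δ (toPoly δ p) (toPoly δ q) := rfl

/-- Elements are the left polynomials in `Y`: `a * Yʲ` corresponds to `a yʲ`. -/
theorem toPoly_coef_mul_varY_pow (δ : Derivation K A A) (a : A) (j : ℕ) :
    toPoly δ (coef δ a * varY δ ^ j) = monomial j a := by
  have h : ∀ j : ℕ, toPoly δ (varY δ ^ j) = X ^ j := by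
    intro j
    induction j with
    | zero => rfl
    | succ j ih =>
      rw [pow_succ', toPoly_mul, ih, varY, LinearEquiv.apply_symm_apply]
      have hX : (X : A[X]) = monomial 1 1 := (monomial_one_one_eq_X).symm
      nth_rewrite 1 [hX]
      rw [leftMul_monomial, pow_one, C_1, one_mul, ← mulY_pow_one δ, ← mulY_pow_one δ (j + 1),
        pow_succ', Module.End.mul_apply]
  rw [toPoly_mul, h, coef, LinearEquiv.apply_symm_apply, ← monomial_zero_left, leftMul_monomial]
  simp [C_mul_X_pow_eq_monomial]

theorem coef_mul (δ : Derivation K A A) (a b : A) : coef δ (a * b) = coef δ a * coef δ b := by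
  apply (toPoly δ).injective
  rw [toPoly_mul]
  simp only [coef, LinearEquiv.apply_symm_apply]
  rw [← monomial_zero_left (a := a), leftMul_monomial]
  simp

/-- The defining commutation relation `Y a = a Y + δ(a)`. -/
theorem varY_mul_coef (δ : Derivation K A A) (a : A) :
    varY δ * coef δ a = coef δ a * varY δ + coef δ (δ a) := by
  apply (toPoly δ).injective
  rw [map_add, toPoly_mul, toPoly_mul]
  simp only [coef, varY, LinearEquiv.apply_symm_apply]
  rw [← monomial_one_one_eq_X, leftMul_monomial, ← monomial_zero_left (a := a), leftMul_monomial,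
    pow_one, mulY_monomial]
  simp

end OreExtension

end Ore

/-! ## The algebras `A₁⁽ˡ⁾` and `L⁽ˡ⁾` -/

section WeylL

variable {K : Type*} [Field K]

/-- The linear map `δ(Zᵐ) = (m / l) Zᵐ⁻ˡ` on Laurent polynomials in `Z`. -/
noncomputable def laurentDerivLin (K : Type*) [Field K] (l : ℕ) :
    LaurentPolynomial K →ₗ[K] LaurentPolynomial K :=
  (Finsupp.lsum K fun m : ℤ =>
      LinearMap.toSpanSingleton K (LaurentPolynomial K)
        (((m : K) / (l : K)) • LaurentPolynomial.T (m - (l : ℤ)))) ∘ₗ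
    (AddMonoidAlgebra.coeffLinearEquiv K).toLinearMap

theorem laurentDerivLin_C_mul_T (l : ℕ) (m : ℤ) (a : K) :
    laurentDerivLin K l (LaurentPolynomial.C a * LaurentPolynomial.T m) =
      a • ((m : K) / (l : K)) • LaurentPolynomial.T (m - (l : ℤ)) := by
  rw [← LaurentPolynomial.single_eq_C_mul_T]
  simp [laurentDerivLin, -LaurentPolynomial.single_eq_C_mul_T]

/-- The derivation `δ` of `K[Z, Z⁻¹]` with `δ(Z) = (1 / l) Z¹⁻ˡ`. -/
noncomputable def laurentDeriv (K : Type*) [Field K] (l : ℕ) :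
    Derivation K (LaurentPolynomial K) (LaurentPolynomial K) :=
  Derivation.mk' (laurentDerivLin K l) (by
    intro p q
    induction p using LaurentPolynomial.induction_on' with
    | add p p' hp hp' => simp only [add_mul, map_add, hp, hp', smul_eq_mul]; ring
    | C_mul_T m a =>
      induction q using LaurentPolynomial.induction_on' with
      | add q q' hq hq' => simp only [mul_add, map_add, hq, hq', smul_eq_mul]; ring
      | C_mul_T n b =>
        have h : (LaurentPolynomial.C a * LaurentPolynomial.T m) *
            (LaurentPolynomial.C b * LaurentPolynomial.T n) =
            LaurentPolynomial.C (a * b) * LaurentPolynomial.T (m + n) := by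
          rw [LaurentPolynomial.T_add, map_mul]; ring
        rw [h, laurentDerivLin_C_mul_T, laurentDerivLin_C_mul_T, laurentDerivLin_C_mul_T]
        have e1 : m + n - (l : ℤ) = m + (n - l) := by ring
        have e2 : n + (m - (l : ℤ)) = m + (n - l) := by ring
        simp only [LaurentPolynomial.smul_eq_C_mul, smul_eq_mul]
        have h1 : (LaurentPolynomial.T m * LaurentPolynomial.T (n - (l : ℤ)) :
            LaurentPolynomial K) = LaurentPolynomial.T (m + (n - l)) :=
          (LaurentPolynomial.T_add _ _).symm
        have h2 : (LaurentPolynomial.T n * LaurentPolynomial.T (m - (l : ℤ)) :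
            LaurentPolynomial K) = LaurentPolynomial.T (m + (n - l)) := by
          rw [← LaurentPolynomial.T_add, e2]
        rw [e1]
        have h3 : (((m + n : ℤ) : K) / (l : K)) = (m : K) / l + (n : K) / l := by
          push_cast; ring
        rw [h3, map_mul, map_add]
        linear_combination
          (-(LaurentPolynomial.C a * LaurentPolynomial.C b * LaurentPolynomial.C ((n : K) / l))) * h1
          - (LaurentPolynomial.C a * LaurentPolynomial.C b * LaurentPolynomial.C ((m : K) / l)) * h2)

/-- The value of the derivation on the generator: `δ(Z) = (1 / l) Z¹⁻ˡ`. -/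
theorem laurentDeriv_T_one (l : ℕ) :
    laurentDeriv K l (LaurentPolynomial.T 1) =
      (1 / (l : K)) • LaurentPolynomial.T (1 - (l : ℤ)) := by
  have h := laurentDerivLin_C_mul_T (K := K) l 1 1
  simpa [laurentDeriv] using h

/-- `A₁⁽ˡ⁾`: the Ore extension `K[Z, Z⁻¹][Y; id, δ]`, where `Z = X^(1/l)`. -/
abbrev WeylL (K : Type*) [Field K] (l : ℕ) : Type _ := OreExtension (laurentDeriv K l)

/-- `L⁽ˡ⁾ = K[x^(1/l), x^(-1/l), y]`; the Laurent monomial `T i` stands for `x^(i/l)`. -/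
abbrev LPoly (K : Type*) [Field K] : Type _ := (LaurentPolynomial K)[X]

/-- The linear map `Ψ⁽ˡ⁾ : A₁⁽ˡ⁾ → L⁽ˡ⁾`, `X^(i/l) Yʲ ↦ x^(i/l) yʲ`. -/
noncomputable def weylPsi (K : Type*) [Field K] (l : ℕ) : WeylL K l ≃ₗ[K] LPoly K :=
  OreExtension.toPoly (laurentDeriv K l)

/-- `A₁` inside `A₁⁽ˡ⁾`: the subalgebra generated by `X = Zˡ` and `Y`. -/
noncomputable def weylA1 (K : Type*) [Field K] (l : ℕ) : Subalgebra K (WeylL K l) :=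
  Algebra.adjoin K
    {OreExtension.coef (laurentDeriv K l) (LaurentPolynomial.T (l : ℤ)),
      OreExtension.varY (laurentDeriv K l)}

/-! ## Directions, degrees, leading terms, start and end points -/

/-- `(ρ, σ)` is a direction: coprime integers with `ρ + σ > 0`. -/
def IsDirection (ρ σ : ℤ) : Prop := IsCoprime ρ σ ∧ 0 < ρ + σ

/-- `v_{ρ,σ}(a, b) = ρ a + σ b`. -/
def pointDeg (ρ σ : ℤ) (a : ℚ × ℚ) : ℚ := (ρ : ℚ) * a.1 + (σ : ℚ) * a.2

/-- Two points of the plane are aligned if their determinant vanishes. -/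
def Aligned (a b : ℚ × ℚ) : Prop := a.1 * b.2 - a.2 * b.1 = 0

namespace LPoly

/-- The point `(i/l, j)`. -/
def pt (l : ℕ) (i : ℤ) (j : ℕ) : ℚ × ℚ := ((i : ℚ) / (l : ℚ), (j : ℚ))

/-- The support: the set of `(i/l, j)` such that `x^(i/l) yʲ` has a nonzero coefficient. -/
noncomputable def supp (l : ℕ) (p : LPoly K) : Finset (ℚ × ℚ) :=
  p.support.biUnion fun j => (p.coeff j).coeff.support.image fun i => pt l i j

/-- The `(ρ,σ)`-degree `v_{ρ,σ}(p)`, equal to `⊥ = -∞` for `p = 0`. -/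
noncomputable def deg (l : ℕ) (ρ σ : ℤ) (p : LPoly K) : WithBot ℚ :=
  ((supp l p).image (pointDeg ρ σ)).max

open Classical in
/-- The `(ρ,σ)`-leading term `ℓ_{ρ,σ}(p)`: the sum of the terms of `p` of maximal degree. -/
noncomputable def lead (l : ℕ) (ρ σ : ℤ) (p : LPoly K) : LPoly K :=
  ∑ j ∈ p.support, Polynomial.monomial j
    (AddMonoidAlgebra.ofCoeff ((p.coeff j).coeff.filter fun i : ℤ =>
      ((pointDeg ρ σ (pt l i j) : ℚ) : WithBot ℚ) = deg l ρ σ p))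

/-- `p` is `(ρ,σ)`-homogeneous. -/
def IsHomog (l : ℕ) (ρ σ : ℤ) (p : LPoly K) : Prop := p = 0 ∨ p = lead l ρ σ p

/-- `w(p)` for `p ≠ 0`: the point of `Supp(ℓ_{1,-1}(p))` with the largest first coordinate `a`;
its second coordinate is `a - v_{1,-1}(p)`. -/
noncomputable def w (l : ℕ) (p : LPoly K) : ℚ × ℚ :=
  let a : ℚ := (((supp l (lead l 1 (-1) p)).image Prod.fst).max).unbotD 0
  (a, a - (deg l 1 (-1) p).unbotD 0)

/-- `w̄(p)` for `p ≠ 0`: the point of `Supp(ℓ_{-1,1}(p))` with the largest second coordinate `b`;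
its first coordinate is `b - v_{-1,1}(p)`. -/
noncomputable def wBar (l : ℕ) (p : LPoly K) : ℚ × ℚ :=
  let b : ℚ := (((supp l (lead l (-1) 1 p)).image Prod.snd).max).unbotD 0
  (b - (deg l (-1) 1 p).unbotD 0, b)

end LPoly

namespace WeylL

/-- `v_{ρ,σ}(P)` for `P ∈ A₁⁽ˡ⁾`. -/
noncomputable def deg {l : ℕ} (ρ σ : ℤ) (P : WeylL K l) : WithBot ℚ :=
  LPoly.deg l ρ σ (weylPsi K l P)

/-- `ℓ_{ρ,σ}(P) ∈ L⁽ˡ⁾` for `P ∈ A₁⁽ˡ⁾`. -/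
noncomputable def lead {l : ℕ} (ρ σ : ℤ) (P : WeylL K l) : LPoly K :=
  LPoly.lead l ρ σ (weylPsi K l P)

/-- `P ∈ A₁⁽ˡ⁾` is `(ρ,σ)`-homogeneous. -/
def IsHomog {l : ℕ} (ρ σ : ℤ) (P : WeylL K l) : Prop :=
  LPoly.IsHomog l ρ σ (weylPsi K l P)

/-- The start point `st_{ρ,σ}(P) = w(ℓ_{ρ,σ}(P))`. -/
noncomputable def st {l : ℕ} (ρ σ : ℤ) (P : WeylL K l) : ℚ × ℚ :=
  LPoly.w l (lead ρ σ P)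

/-- The end point `en_{ρ,σ}(P) = w̄(ℓ_{ρ,σ}(P))`. -/
noncomputable def en {l : ℕ} (ρ σ : ℤ) (P : WeylL K l) : ℚ × ℚ :=
  LPoly.wBar l (lead ρ σ P)

/-- `P` and `Q` are `(ρ,σ)`-proportional: `v([P,Q]) < v(P) + v(Q) - (ρ + σ)`. -/
def Proportional {l : ℕ} (ρ σ : ℤ) (P Q : WeylL K l) : Prop :=
  deg ρ σ (P * Q - Q * P) < deg ρ σ P + deg ρ σ Q + ((-((ρ : ℚ) + (σ : ℚ)) : ℚ) : WithBot ℚ)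

open Classical in
/-- The bracket `[P,Q]_{ρ,σ} ∈ L⁽ˡ⁾` (used for `P, Q ≠ 0`): zero if `P` and `Q` are
`(ρ,σ)`-proportional, and `ℓ_{ρ,σ}([P,Q])` otherwise. -/
noncomputable def bracket {l : ℕ} (ρ σ : ℤ) (P Q : WeylL K l) : LPoly K :=
  if Proportional ρ σ P Q then 0 else lead ρ σ (P * Q - Q * P)

end WeylL

end WeylL

/-! Give exponents the integer weight `wt ρ (l * σ)`, which is `l` times the `(ρ,σ)`-degree. Up to
lower weight, a commutator in `A₁⁽ˡ⁾` is a Poisson bracket in `L⁽ˡ⁾` (`psi_commutator_sub_mem`).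
With `p = ℓ(P)`, it therefore suffices to find a homogeneous `f` of weight `l(ρ+σ)` with `{p, f} =
p`, and to set `F = Ψ⁻¹(f)`.

If `h = {p, g} ≠ 0` and `{p, h} = 0`, then formally `f = g p / h` is a solution. Such a `g` is the
leading form of a word in `P` and `Q`. Because `[Q, P] = 1`, bracketing with `P` acts on normally
ordered words as `-∂/∂Q`, hence is locally nilpotent. Starting from a word whose leading form does
not commute with `p`, iterate up to the last nonzero bracket (`exists_word_second_order`). A
starting word comes from a dimension count (`exists_word_not_commuting`): a form commuting with `p`
has its corner on a fixed ray, with one possible position per weight, while the number of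
independent words grows quadratically. If `p` is a monomial in `x` alone, `f` is written down
directly.

That `g p / h` has no denominator is `dvd_mul_of_wronskian`: Euler's identity, or direct computation
when `ρ = 0`, turns both bracket conditions into first order equations in one variable, and the
order at a prime of the reduced denominator gives a contradiction in characteristic zero.

The end points are handled by `corner_dichotomy`. At the sum of the corners of `p` and `f`, shifted
by `-(l, 1)`, the coefficient of `{p, f}` is a nonzero multiple of their determinant. Since `{p, f}
= p`, either the determinant vanishes or the shift returns the corner of `p`, so that the corner of
`f` is `(l, 1)`, the point `(1, 1)` of the plane. -/

/-! ### Derivations and prime divisors. -/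

section DerivationDivisibility

variable {K R : Type*} [Field K] [CharZero K] [CommRing R] [IsDomain R] [Algebra K R]

/-- In characteristic zero, a prime `q` not dividing `D q` and not dividing `a` does not divide any
`v ≠ 0` with `v ∣ a * D v`. -/
theorem not_dvd_of_dvd_mul_derivation [UniqueFactorizationMonoid R] (D : Derivation K R R)
    {q : R} (hq : Prime q) (hDq : ¬ q ∣ D q) {a v : R} (hv : v ≠ 0) (hqa : ¬ q ∣ a)
    (h : v ∣ a * D v) : ¬ q ∣ v := by
  intro hqv
  obtain ⟨w, hvw, hw⟩ := (FiniteMultiplicity.of_prime_left hq hv).exists_eq_pow_mul_and_not_dvd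
  generalize multiplicity q v = e at hvw
  subst hvw
  obtain _ | e := e
  · simp only [pow_zero, one_mul] at hqv; exact hw hqv
  -- The full power of `q` must divide `D v`, whose term `(e + 1) q ^ e w D q` has order exactly
  -- `e`.
  have h1 : q ^ (e + 1) ∣ D (q ^ (e + 1) * w) :=
    hq.pow_dvd_of_dvd_mul_left _ hqa (dvd_trans (dvd_mul_right _ _) h)
  rw [Derivation.leibniz, Derivation.leibniz_pow, smul_eq_mul, smul_eq_mul, smul_eq_mul,
    nsmul_eq_mul, Nat.add_sub_cancel, dvd_add_right (dvd_mul_right _ _), pow_succ] at h1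
  have h2 : q ^ e * q ∣ q ^ e * (((e + 1 : ℕ) : R) * (w * D q)) := by
    convert h1 using 1; ring
  have h3 := (mul_dvd_mul_iff_left (pow_ne_zero e hq.ne_zero)).1 h2
  have hu : IsUnit (((e + 1 : ℕ) : R)) := by
    have : ((e + 1 : ℕ) : R) = algebraMap K R ((e + 1 : ℕ) : K) := by simp
    rw [this]
    exact (IsUnit.mk0 _ (Nat.cast_ne_zero.2 (Nat.succ_ne_zero e))).map _
  rw [hu.dvd_mul_left] at h3
  exact (hq.dvd_or_dvd h3).elim hw hDq

/-- A divisibility criterion: the solution `g * p / h` of a first order equation is integral. -/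
theorem dvd_mul_of_wronskian [UniqueFactorizationMonoid R] (D : Derivation K R R)
    (hD : ∀ q : R, Prime q → ¬ q ∣ D q) {p g h u : R} {α β γ : ℤ} (hα : 0 < α)
    (hs : 0 < α + β - γ) (hp : p ≠ 0) (hh : h ≠ 0)
    (h1 : u * h = (β : R) * (g * D p) - (α : R) * (p * D g))
    (h2 : (γ : R) * (h * D p) = (α : R) * (p * D h)) : h ∣ g * p := by
  obtain ⟨A, B, d, hAB, hA, hB⟩ := UniqueFactorizationMonoid.exists_reduced_factors' (g * p) h hh
  obtain ⟨a, ha⟩ : ∃ a : ℕ, α = a + 1 := ⟨(α - 1).toNat, by omega⟩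
  obtain ⟨s, hs'⟩ : ∃ s : ℕ, α + β - γ = s + 1 := ⟨(α + β - γ - 1).toNat, by omega⟩
  have hB0 : B ≠ 0 := by rintro rfl; simp at hB; exact hh hB.symm
  have e1 : h * A = g * p * B := by rw [← hA, ← hB]; ring
  have e2 : h * D A + A * D h = (g * D p + p * D g) * B + g * p * D B := by
    have := congrArg D e1
    simp only [Derivation.leibniz, smul_eq_mul] at this
    linear_combination this
  have hβ : (β : R) = (s : R) + 1 - α + γ := by
    have : β = (s : ℤ) + 1 - α + γ := by omega
    rw [this]; push_cast; ring
  have hα' : (α : R) = a + 1 := by rw [ha]; push_cast; ring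
  -- With `g p / h = A / B` in lowest terms, `h1` and `h2` combine into an equation free of `g` and
  -- `h`. Up to the factor `p ^ s * B ^ a`, its left side is `A * D (p ^ (s + 1) * B ^ (a + 1))`.
  have e3 : A * ((α : R) * (p * D B) + ((s : R) + 1) * (B * D p)) =
      p * B * ((α : R) * D A + u * B) := by
    apply mul_left_cancel₀ hh
    rw [hβ] at h1
    linear_combination (-(α : R) * p * B) * e2 + (-B * B * p) * h1 + (-A * B) * h2 +
      ((α : R) * p * D B + (s + 1 + γ : R) * B * D p) * e1
  have hv : p ^ (s + 1) * B ^ (a + 1) ∣ A * D (p ^ (s + 1) * B ^ (a + 1)) := by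
    refine ⟨(α : R) * D A + u * B, ?_⟩
    rw [Derivation.leibniz, Derivation.leibniz_pow, Derivation.leibniz_pow]
    simp only [smul_eq_mul, nsmul_eq_mul, Nat.add_sub_cancel]
    push_cast
    rw [hα'] at e3 ⊢
    linear_combination (p ^ s * B ^ a) * e3
  -- A prime factor of `B` does not divide `A`, yet divides the element `v` of `hv`; the previous
  -- lemma excludes this.
  have hBu : IsUnit B := by
    by_contra hBu
    obtain ⟨q, hq, hqB⟩ := WfDvdMonoid.exists_irreducible_factor hBu hB0
    have hq' := hq.prime
    refine not_dvd_of_dvd_mul_derivation D hq' (hD q hq') (a := A)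
      (mul_ne_zero (pow_ne_zero _ hp) (pow_ne_zero _ hB0)) (fun hqA => ?_) hv
      (dvd_mul_of_dvd_right (dvd_pow hqB (Nat.succ_ne_zero a)) _)
    exact hq.not_isUnit (hAB hqA hqB)
  rw [← hA, ← hB, hBu.mul_right_dvd]
  exact dvd_mul_right _ _

theorem Polynomial.not_dvd_derivative_of_prime {q : K[X]} (hq : Prime q) :
    ¬ q ∣ derivative q := by
  intro h
  have h0 := eq_zero_of_dvd_of_degree_lt h (degree_derivative_lt hq.ne_zero)
  have := derivative_eq_zero.1 h0
  rw [natDegree_eq_zero] at this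
  obtain ⟨c, rfl⟩ := this
  apply hq.not_isUnit
  rw [isUnit_C, isUnit_iff_ne_zero]
  rintro rfl
  exact hq.ne_zero C_0

end DerivationDivisibility

/-! ### Laurent polynomials: factoriality and the derivation. -/

section Laurent

variable {K : Type*} [Field K]

instance LaurentPolynomial.instUniqueFactorizationMonoid :
    UniqueFactorizationMonoid (LaurentPolynomial K) :=
  UniqueFactorizationMonoid.of_isLocalization (S := Submonoid.powers (X : K[X])) _

theorem laurentDeriv_T (l : ℕ) (m : ℤ) :
    laurentDeriv K l (LaurentPolynomial.T m) =
      ((m : K) / (l : K)) • LaurentPolynomial.T (m - (l : ℤ)) := by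
  simpa [laurentDeriv] using laurentDerivLin_C_mul_T (K := K) l m 1

theorem laurentDeriv_toLaurent (l : ℕ) (q : K[X]) :
    laurentDeriv K l (toLaurent q) =
      (1 / (l : K)) • (LaurentPolynomial.T (1 - (l : ℤ)) * toLaurent (derivative q)) := by
  induction q using Polynomial.induction_on' with
  | add p q hp hq => simp only [map_add, hp, hq, mul_add, smul_add]
  | monomial n c =>
    rw [derivative_monomial, ← C_mul_X_pow_eq_monomial, ← C_mul_X_pow_eq_monomial,
      toLaurent_C_mul_X_pow, toLaurent_C_mul_X_pow, ← LaurentPolynomial.smul_eq_C_mul,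
      ← LaurentPolynomial.smul_eq_C_mul, Derivation.map_smul, laurentDeriv_T, mul_smul_comm,
      ← LaurentPolynomial.T_add, smul_smul, smul_smul]
    obtain _ | n := n
    · simp
    · have : (1 - (l : ℤ) + ((n + 1 - 1 : ℕ) : ℤ)) = ((n + 1 : ℕ) : ℤ) - l := by
        push_cast; ring
      rw [this]; congr 1; push_cast; ring

/-- Up to a unit, `q` is an ordinary polynomial prime to `X`, on which the derivation is the usual
derivative times a unit. A polynomial dividing its own derivative is constant in characteristic
zero. -/
theorem laurentDeriv_prime [CharZero K] {l : ℕ} (hl : 0 < l) {q : LaurentPolynomial K}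
    (hq : Prime q) : ¬ q ∣ laurentDeriv K l q := by
  intro hd
  obtain ⟨n, Q, hQ⟩ := LaurentPolynomial.exists_T_pow q
  have hl' : (1 / (l : K)) ≠ 0 := by simp; omega
  have hQ0 : Q ≠ 0 := by
    rintro rfl
    rw [map_zero, eq_comm, (LaurentPolynomial.isUnit_T _).mul_left_eq_zero] at hQ
    exact hq.ne_zero hQ
  obtain ⟨Q₁, hQ₁, hX⟩ :=
    (FiniteMultiplicity.of_prime_left prime_X hQ0).exists_eq_pow_mul_and_not_dvd
  generalize multiplicity X Q = k at hQ₁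
  obtain ⟨v, hv⟩ : ∃ v : (LaurentPolynomial K)ˣ, toLaurent Q₁ = q * v := by
    refine ⟨(LaurentPolynomial.isUnit_T (n - k : ℤ)).unit, ?_⟩
    rw [hQ₁, map_mul, toLaurent_X_pow] at hQ
    rw [IsUnit.unit_spec, LaurentPolynomial.T_sub, ← mul_assoc, ← hQ, mul_comm, ← mul_assoc,
      ← LaurentPolynomial.T_add]
    simp
  have h1 : toLaurent Q₁ ∣ toLaurent (derivative Q₁) := by
    have h2 : q ∣ laurentDeriv K l (toLaurent Q₁) := by
      rw [hv, Derivation.leibniz]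
      exact dvd_add (dvd_mul_right _ _) (dvd_mul_of_dvd_right hd _)
    rw [laurentDeriv_toLaurent, LaurentPolynomial.smul_eq_C_mul,
      ((IsUnit.mk0 _ hl').map LaurentPolynomial.C).dvd_mul_left,
      (LaurentPolynomial.isUnit_T _).dvd_mul_left] at h2
    rw [hv]
    exact (v.isUnit.mul_right_dvd).2 h2
  obtain ⟨r, hr⟩ := h1
  obtain ⟨m, R, hR⟩ := LaurentPolynomial.exists_T_pow r
  have h2 : Q₁ ∣ X ^ m * derivative Q₁ := by
    refine ⟨R, toLaurent_injective ?_⟩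
    rw [map_mul, map_mul, hR, hr, toLaurent_X_pow]; ring
  have h3 : IsCoprime Q₁ (X ^ m) :=
    ((irreducible_X.coprime_iff_not_dvd).2 hX).symm.pow_right
  have h4 := h3.dvd_of_dvd_mul_left h2
  have hQ₁0 : Q₁ ≠ 0 := by rintro rfl; simp at hX
  have h0 := eq_zero_of_dvd_of_degree_lt h4 (degree_derivative_lt hQ₁0)
  have := derivative_eq_zero.1 h0
  rw [natDegree_eq_zero] at this
  obtain ⟨c, rfl⟩ := this
  have hc : c ≠ 0 := by rintro rfl; exact hQ₁0 C_0
  have hu : IsUnit (q * (v : LaurentPolynomial K)) := by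
    rw [← hv]; exact ((isUnit_C.2 (IsUnit.mk0 c hc))).map _
  exact hq.not_isUnit (isUnit_of_mul_isUnit_left hu)

end Laurent

/-! ### Coefficients, supports and weights in `L⁽ˡ⁾`. -/

section Coefficients

namespace LPoly

variable {K : Type*} [Field K]

/-- The coefficient of `x^(i/l) yʲ`, as a linear form. -/
noncomputable def coef (i : ℤ) (j : ℕ) : LPoly K →ₗ[K] K where
  toFun p := (p.coeff j).coeff i
  map_add' p q := by simp
  map_smul' c p := by simp

/-- The monomial `x^(i/l) yʲ`. -/
noncomputable def mon (i : ℤ) (j : ℕ) : LPoly K := monomial j (LaurentPolynomial.T i)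

theorem coef_apply (i : ℤ) (j : ℕ) (p : LPoly K) : coef i j p = (p.coeff j).coeff i := rfl

theorem ext_coef {p q : LPoly K} (h : ∀ i j, coef i j p = coef i j q) : p = q := by
  ext j i; exact h i j

theorem coef_mon (i i' : ℤ) (j j' : ℕ) :
    coef i j (mon i' j' : LPoly K) = if i' = i ∧ j' = j then 1 else 0 := by
  rw [coef_apply, mon, coeff_monomial]
  split_ifs <;> simp_all

theorem coef_mon_self (i : ℤ) (j : ℕ) : coef i j (mon i j : LPoly K) = 1 := by
  simp [coef_mon]

theorem mon_mul_mon (i i' : ℤ) (j j' : ℕ) :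
    (mon i j * mon i' j' : LPoly K) = mon (i + i') (j + j') := by
  rw [mon, mon, mon, monomial_mul_monomial, LaurentPolynomial.T_add]

/-- The finite set of exponents of `p`. -/
noncomputable def exps (p : LPoly K) : Finset (ℤ × ℕ) :=
  p.support.biUnion fun j => (p.coeff j).coeff.support.image fun i => (i, j)

theorem mem_exps {p : LPoly K} {i : ℤ} {j : ℕ} : (i, j) ∈ exps p ↔ coef i j p ≠ 0 := by
  simp only [exps, Finset.mem_biUnion, Finset.mem_image, Prod.mk.injEq, coef_apply,
    Finsupp.mem_support_iff, Polynomial.mem_support_iff]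
  constructor
  · rintro ⟨j', -, i', h, rfl, rfl⟩; exact h
  · intro h
    refine ⟨j, fun h0 => h ?_, i, h, rfl, rfl⟩
    rw [h0]; rfl

theorem exists_coef_ne_zero {p : LPoly K} (hp : p ≠ 0) : ∃ i j, coef i j p ≠ 0 := by
  by_contra! h
  exact hp (ext_coef fun i j => by rw [h, map_zero])

theorem exps_nonempty {p : LPoly K} (hp : p ≠ 0) : (exps p).Nonempty := by
  obtain ⟨i, j, h⟩ := exists_coef_ne_zero hp
  exact ⟨(i, j), mem_exps.2 h⟩

theorem sum_coef_smul_mon (p : LPoly K) :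
    ∑ x ∈ exps p, coef x.1 x.2 p • (mon x.1 x.2 : LPoly K) = p := by
  refine ext_coef fun i j => ?_
  rw [map_sum, Finset.sum_eq_single (i, j)]
  · rw [map_smul, coef_mon_self, smul_eq_mul, mul_one]
  · rintro ⟨i', j'⟩ - hne
    rw [map_smul, coef_mon, if_neg, smul_zero]
    rintro ⟨rfl, rfl⟩; exact hne rfl
  · intro h
    rw [mem_exps, not_not] at h
    rw [map_smul]; simp only [h, zero_smul]

/-- The elements whose exponents lie in `S`. -/
noncomputable def suppIn (K : Type*) [Field K] (S : Set (ℤ × ℕ)) : Submodule K (LPoly K) where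
  carrier := {p | ∀ i j, (i, j) ∉ S → coef i j p = 0}
  add_mem' hp hq i j h := by rw [map_add, hp i j h, hq i j h, add_zero]
  zero_mem' i j _ := map_zero _
  smul_mem' c p hp i j h := by rw [map_smul, hp i j h, smul_zero]

theorem mem_suppIn {S : Set (ℤ × ℕ)} {p : LPoly K} :
    p ∈ suppIn K S ↔ ∀ i j, (i, j) ∉ S → coef i j p = 0 := Iff.rfl

theorem mon_mem_suppIn {S : Set (ℤ × ℕ)} {i : ℤ} {j : ℕ} (h : (i, j) ∈ S) :
    mon i j ∈ suppIn K S := by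
  intro i' j' h'
  rw [coef_mon, if_neg]
  rintro ⟨rfl, rfl⟩; exact h' h

theorem suppIn_mono {S S' : Set (ℤ × ℕ)} (h : S ⊆ S') : suppIn K S ≤ suppIn K S' :=
  fun _ hp i j hij => hp i j fun h' => hij (h h')

theorem suppIn_le_iff {S : Set (ℤ × ℕ)} {N : Submodule K (LPoly K)} :
    suppIn K S ≤ N ↔ ∀ i j, (i, j) ∈ S → mon i j ∈ N := by
  refine ⟨fun h i j hij => h (mon_mem_suppIn hij), fun h p hp => ?_⟩
  rw [← sum_coef_smul_mon p]
  refine Submodule.sum_mem _ fun x hx => ?_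
  by_cases hS : x ∈ S
  · exact N.smul_mem _ (h _ _ hS)
  · exact absurd (hp _ _ hS) (mem_exps.1 hx)

theorem suppIn_map {S S' : Set (ℤ × ℕ)} (f : LPoly K →ₗ[K] LPoly K)
    (h : ∀ i j, (i, j) ∈ S → f (mon i j) ∈ suppIn K S') {p : LPoly K} (hp : p ∈ suppIn K S) :
    f p ∈ suppIn K S' :=
  (suppIn_le_iff (N := (suppIn K S').comap f)).2 h hp

theorem suppIn_mul {S S' S'' : Set (ℤ × ℕ)} (h : ∀ x ∈ S, ∀ y ∈ S', x + y ∈ S'')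
    {p q : LPoly K} (hp : p ∈ suppIn K S) (hq : q ∈ suppIn K S') : p * q ∈ suppIn K S'' := by
  refine suppIn_map (LinearMap.mulRight K q) (fun i j hij => ?_) hp
  refine suppIn_map (LinearMap.mulLeft K (mon i j)) (fun i' j' hij' => ?_) hq
  rw [LinearMap.mulLeft_apply, mon_mul_mon]
  exact mon_mem_suppIn (h _ hij _ hij')

theorem eq_zero_of_mem_suppIn_disjoint {S S' : Set (ℤ × ℕ)} (h : Disjoint S S') {p : LPoly K}
    (hp : p ∈ suppIn K S) (hp' : p ∈ suppIn K S') : p = 0 := by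
  refine ext_coef fun i j => ?_
  rw [map_zero]
  by_cases hS : (i, j) ∈ S
  · exact hp' i j (Set.disjoint_left.1 h hS)
  · exact hp i j hS

theorem exists_add_suppIn (S : Set (ℤ × ℕ)) (p : LPoly K) :
    ∃ q ∈ suppIn K S, ∃ r ∈ suppIn K Sᶜ, p = q + r := by
  classical
  refine ⟨∑ x ∈ exps p with x ∈ S, coef x.1 x.2 p • (mon x.1 x.2 : LPoly K),
    Submodule.sum_mem _ fun x hx => Submodule.smul_mem _ _ (mon_mem_suppIn (Finset.mem_filter.1 hx).2),
    ∑ x ∈ exps p with x ∉ S, coef x.1 x.2 p • (mon x.1 x.2 : LPoly K),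
    Submodule.sum_mem _ fun x hx => Submodule.smul_mem _ _ (mon_mem_suppIn (Finset.mem_filter.1 hx).2), ?_⟩
  rw [Finset.sum_filter_add_sum_filter_not, sum_coef_smul_mon]

/-- If `h ≠ 0` and `h * f` are supported in suitable classes, so is `f`. -/
theorem mem_suppIn_of_mul_mem {S S₁ S₂ : Set (ℤ × ℕ)} {h f : LPoly K} (hh : h ≠ 0)
    (hS₁ : h ∈ suppIn K S₁) (hf : h * f ∈ suppIn K S₂) (hS : ∀ x ∈ S₁, ∀ y, x + y ∈ S₂ ↔ y ∈ S) :
    f ∈ suppIn K S := by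
  obtain ⟨q, hq, r, hr, rfl⟩ := exists_add_suppIn S f
  have h1 : h * q ∈ suppIn K S₂ := suppIn_mul (fun x hx y hy => (hS x hx y).2 hy) hS₁ hq
  have h2 : h * r ∈ suppIn K S₂ᶜ :=
    suppIn_mul (fun x hx y hy => mt (hS x hx y).1 hy) hS₁ hr
  have h3 : h * r ∈ suppIn K S₂ := by
    have := Submodule.sub_mem _ hf h1
    rwa [mul_add, add_sub_cancel_left] at this
  have h4 := eq_zero_of_mem_suppIn_disjoint disjoint_compl_right h3 h2
  rw [(mul_eq_zero.1 h4).resolve_left hh, add_zero]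
  exact hq

/-- The `(a,b)`-weight of an exponent. -/
def wt (a b : ℤ) (x : ℤ × ℕ) : ℤ := a * x.1 + b * x.2

theorem wt_add (a b : ℤ) (x y : ℤ × ℕ) : wt a b (x + y) = wt a b x + wt a b y := by
  simp [wt]; ring

/-- The elements of weight at most `d`. -/
noncomputable def filt (K : Type*) [Field K] (a b d : ℤ) : Submodule K (LPoly K) :=
  suppIn K {x | wt a b x ≤ d}

/-- The homogeneous elements of weight `d`. -/
noncomputable def homog (K : Type*) [Field K] (a b d : ℤ) : Submodule K (LPoly K) :=
  suppIn K {x | wt a b x = d}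

theorem homog_le_filt (a b d : ℤ) : homog K a b d ≤ filt K a b d :=
  suppIn_mono fun _ h => le_of_eq h

theorem filt_mono {a b d d' : ℤ} (h : d ≤ d') : filt K a b d ≤ filt K a b d' :=
  suppIn_mono fun _ hx => le_trans hx h

theorem filt_mul {a b d e : ℤ} {p q : LPoly K} (hp : p ∈ filt K a b d) (hq : q ∈ filt K a b e) :
    p * q ∈ filt K a b (d + e) :=
  suppIn_mul (fun x hx y hy => by
    simp only [Set.mem_ofPred_eq, wt_add] at *; exact add_le_add hx hy) hp hq

theorem homog_mul {a b d e : ℤ} {p q : LPoly K} (hp : p ∈ homog K a b d)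
    (hq : q ∈ homog K a b e) : p * q ∈ homog K a b (d + e) :=
  suppIn_mul (fun x hx y hy => by
    simp only [Set.mem_ofPred_eq, wt_add] at *; rw [hx, hy]) hp hq

theorem coef_eq_zero_of_filt {a b d : ℤ} {p : LPoly K} (hp : p ∈ filt K a b d) {i : ℤ} {j : ℕ}
    (h : d < wt a b (i, j)) : coef i j p = 0 := hp i j (not_le.2 h)

theorem wt_eq_of_homog {a b d : ℤ} {p : LPoly K} (hp : p ∈ homog K a b d) {i : ℤ} {j : ℕ}
    (h : coef i j p ≠ 0) : wt a b (i, j) = d := by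
  by_contra hne; exact h (hp i j hne)

theorem eq_zero_of_homog_of_filt {a b d e : ℤ} {p : LPoly K} (hp : p ∈ homog K a b d)
    (hp' : p ∈ filt K a b e) (h : e < d) : p = 0 :=
  eq_zero_of_mem_suppIn_disjoint (Set.disjoint_left.2 fun x hx hx' => by
    simp only [Set.mem_ofPred_eq] at *; omega) hp hp'

end LPoly

end Coefficients

/-! ### The Poisson bracket and corners of supports. -/

section Poisson

namespace LPoly

variable {K : Type*} [Field K]

/-- The derivation `∂/∂y`. -/
noncomputable def dY (K : Type*) [Field K] : Derivation K (LPoly K) (LPoly K) :=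
  (Polynomial.derivative' (R := LaurentPolynomial K)).restrictScalars K

/-- The linear map `∂/∂x`, with `x` standing for `Tˡ`. -/
noncomputable def dXLin (K : Type*) [Field K] (l : ℕ) : LPoly K →ₗ[K] LPoly K :=
  Polynomial.lsum fun j =>
    (Polynomial.monomial j).restrictScalars K ∘ₗ (laurentDeriv K l : _ →ₗ[K] LaurentPolynomial K)

theorem dXLin_monomial (l : ℕ) (j : ℕ) (a : LaurentPolynomial K) :
    dXLin K l (monomial j a) = monomial j (laurentDeriv K l a) := by
  simp [dXLin, Polynomial.lsum_apply, Polynomial.sum_monomial_index]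

/-- The derivation `∂/∂x`, with `x` standing for `Tˡ`. -/
noncomputable def dX (K : Type*) [Field K] (l : ℕ) : Derivation K (LPoly K) (LPoly K) :=
  Derivation.mk' (dXLin K l) (by
    intro p q
    induction p using Polynomial.induction_on' with
    | add p p' hp hp' => simp only [add_mul, map_add, hp, hp', smul_eq_mul]; ring
    | monomial m a =>
      induction q using Polynomial.induction_on' with
      | add q q' hq hq' => simp only [mul_add, map_add, hq, hq', smul_eq_mul]; ring
      | monomial n b =>
        simp only [monomial_mul_monomial, dXLin_monomial, smul_eq_mul, Derivation.leibniz, map_add]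
        rw [add_comm n m])

theorem dX_monomial (l : ℕ) (j : ℕ) (a : LaurentPolynomial K) :
    dX K l (monomial j a) = monomial j (laurentDeriv K l a) := dXLin_monomial l j a

theorem dY_apply (p : LPoly K) : dY K p = derivative p := rfl

theorem dY_monomial (j : ℕ) (a : LaurentPolynomial K) :
    dY K (monomial j a) = (j : K) • monomial (j - 1) a := by
  rw [dY_apply, derivative_monomial, smul_monomial, mul_comm, ← nsmul_eq_mul, Nat.cast_smul_eq_nsmul]

theorem dX_mon (l : ℕ) (i : ℤ) (j : ℕ) :
    dX K l (mon i j) = ((i : K) / l) • mon (i - l) j := by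
  rw [mon, mon, dX_monomial, laurentDeriv_T, smul_monomial]

theorem dY_mon (i : ℤ) (j : ℕ) : dY K (mon i j) = (j : K) • mon i (j - 1) := dY_monomial _ _

theorem dX_filt (l : ℕ) {a b d : ℤ} {p : LPoly K} (hp : p ∈ filt K a b d) :
    dX K l p ∈ filt K a b (d - a * l) := by
  refine suppIn_map (dX K l : LPoly K →ₗ[K] LPoly K) (fun i j h => ?_) hp
  rw [Derivation.coeFn_coe, dX_mon]
  refine Submodule.smul_mem _ _ (mon_mem_suppIn ?_)
  simp only [Set.mem_ofPred_eq, wt] at *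
  linarith

theorem dY_filt {a b d : ℤ} {p : LPoly K} (hp : p ∈ filt K a b d) :
    dY K p ∈ filt K a b (d - b) := by
  refine suppIn_map (dY K : LPoly K →ₗ[K] LPoly K) (fun i j h => ?_) hp
  rw [Derivation.coeFn_coe, dY_mon]
  obtain _ | j := j
  · simp
  refine Submodule.smul_mem _ _ (mon_mem_suppIn ?_)
  simp only [Set.mem_ofPred_eq, wt, Nat.add_sub_cancel] at *
  push_cast at h
  linarith

theorem dX_homog (l : ℕ) {a b d : ℤ} {p : LPoly K} (hp : p ∈ homog K a b d) :
    dX K l p ∈ homog K a b (d - a * l) := by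
  refine suppIn_map (dX K l : LPoly K →ₗ[K] LPoly K) (fun i j h => ?_) hp
  rw [Derivation.coeFn_coe, dX_mon]
  refine Submodule.smul_mem _ _ (mon_mem_suppIn ?_)
  simp only [Set.mem_ofPred_eq, wt] at *
  linarith

theorem dY_homog {a b d : ℤ} {p : LPoly K} (hp : p ∈ homog K a b d) :
    dY K p ∈ homog K a b (d - b) := by
  refine suppIn_map (dY K : LPoly K →ₗ[K] LPoly K) (fun i j h => ?_) hp
  rw [Derivation.coeFn_coe, dY_mon]
  obtain _ | j := j
  · simp
  refine Submodule.smul_mem _ _ (mon_mem_suppIn ?_)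
  simp only [Set.mem_ofPred_eq, wt, Nat.add_sub_cancel] at *
  push_cast at h
  linarith

/-- The Poisson bracket `{p, q} = p_y q_x - p_x q_y`. -/
noncomputable def pb (l : ℕ) (p q : LPoly K) : LPoly K := dY K p * dX K l q - dX K l p * dY K q

theorem pb_add_left (l : ℕ) (p p' q : LPoly K) : pb l (p + p') q = pb l p q + pb l p' q := by
  simp only [pb, map_add]; ring

theorem pb_add_right (l : ℕ) (p q q' : LPoly K) : pb l p (q + q') = pb l p q + pb l p q' := by
  simp only [pb, map_add]; ring

theorem pb_smul_left (l : ℕ) (c : K) (p q : LPoly K) : pb l (c • p) q = c • pb l p q := by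
  simp only [pb, Derivation.map_smul, smul_mul_assoc, smul_sub]

theorem pb_smul_right (l : ℕ) (c : K) (p q : LPoly K) : pb l p (c • q) = c • pb l p q := by
  simp only [pb, Derivation.map_smul, mul_smul_comm, smul_sub]

theorem pb_mul_right (l : ℕ) (p q r : LPoly K) : pb l p (q * r) = q * pb l p r + r * pb l p q := by
  simp only [pb, Derivation.leibniz, smul_eq_mul]; ring

theorem pb_self (l : ℕ) (p : LPoly K) : pb l p p = 0 := by
  simp only [pb]; ring

theorem pb_filt (l : ℕ) {a b d e : ℤ} {p q : LPoly K} (hp : p ∈ filt K a b d)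
    (hq : q ∈ filt K a b e) : pb l p q ∈ filt K a b (d + e - (a * l + b)) := by
  refine Submodule.sub_mem _ ?_ ?_
  · convert filt_mul (dY_filt hp) (dX_filt l hq) using 2; ring
  · convert filt_mul (dX_filt l hp) (dY_filt hq) using 2; ring

theorem pb_homog (l : ℕ) {a b d e : ℤ} {p q : LPoly K} (hp : p ∈ homog K a b d)
    (hq : q ∈ homog K a b e) : pb l p q ∈ homog K a b (d + e - (a * l + b)) := by
  refine Submodule.sub_mem _ ?_ ?_
  · convert homog_mul (dY_homog hp) (dX_homog l hq) using 2; ring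
  · convert homog_mul (dX_homog l hp) (dY_homog hq) using 2; ring

theorem pb_mon_mon (l : ℕ) (i i' : ℤ) (j j' : ℕ) :
    pb l (mon i j) (mon i' j' : LPoly K) =
      (((j * i' - i * j' : ℤ) : K) / l) • mon (i + i' - l) (j + j' - 1) := by
  have h1 : dY K (mon i j) * dX K l (mon i' j') =
      ((j : K) * (i' / l)) • mon (i + i' - l) (j + j' - 1) := by
    rw [dY_mon, dX_mon, smul_mul_smul_comm, mon_mul_mon]
    obtain _ | j := j
    · simp
    · congr 2 <;> omega
  have h2 : dX K l (mon i j) * dY K (mon i' j') =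
      ((i : K) / l * j') • mon (i + i' - l) (j + j' - 1) := by
    rw [dY_mon, dX_mon, smul_mul_smul_comm, mon_mul_mon]
    obtain _ | j' := j'
    · simp
    · congr 2; omega
  rw [pb, h1, h2, ← sub_smul]
  congr 1; push_cast; ring

/-- `(i, j)` is the unique exponent of `p` of maximal `(a,b)`-weight. -/
def IsCorner (a b : ℤ) (p : LPoly K) (x : ℤ × ℕ) : Prop :=
  coef x.1 x.2 p ≠ 0 ∧ ∀ i j, coef i j p ≠ 0 → (i, j) ≠ x → wt a b (i, j) < wt a b x

theorem IsCorner.sub_mem {a b : ℤ} {p : LPoly K} {x : ℤ × ℕ} (h : IsCorner a b p x) :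
    p - coef x.1 x.2 p • mon x.1 x.2 ∈ filt K a b (wt a b x - 1) := by
  intro i j hij
  rw [map_sub, map_smul, coef_mon]
  by_cases hx : (i, j) = x
  · subst hx; simp
  · rw [if_neg (by rintro ⟨h1, h2⟩; exact hx (Prod.ext h1.symm h2.symm)), smul_zero, sub_zero]
    by_contra h0
    have := h.2 i j h0 hx
    simp only [Set.mem_ofPred_eq] at hij
    omega

theorem IsCorner.mem_filt {a b : ℤ} {p : LPoly K} {x : ℤ × ℕ} (h : IsCorner a b p x) :
    p ∈ filt K a b (wt a b x) := by
  intro i j hij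
  by_contra h0
  by_cases hx : (i, j) = x
  · exact hij (by rw [hx]; exact le_refl (wt a b x))
  · exact hij (h.2 i j h0 hx).le

/-- The coefficient of a Poisson bracket at the sum of the corners. -/
theorem coef_pb_corner (l : ℕ) {a b : ℤ} {p q : LPoly K} {x y : ℤ × ℕ} (hx : IsCorner a b p x)
    (hy : IsCorner a b q y) (hxy : 0 < x.2 + y.2) :
    coef (x.1 + y.1 - l) (x.2 + y.2 - 1) (pb l p q) =
      coef x.1 x.2 p * coef y.1 y.2 q * (((x.2 * y.1 - x.1 * y.2 : ℤ) : K) / l) := by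
  obtain ⟨r, hr⟩ : ∃ r, r = p - coef x.1 x.2 p • mon x.1 x.2 := ⟨_, rfl⟩
  obtain ⟨s, hs⟩ : ∃ s, s = q - coef y.1 y.2 q • mon y.1 y.2 := ⟨_, rfl⟩
  have hr' := hx.sub_mem
  have hs' := hy.sub_mem
  rw [← hr] at hr'
  rw [← hs] at hs'
  -- Only the bracket of the two corner monomials reaches the top weight; the brackets involving `r`
  -- or `s` lie strictly below it.
  have h1 : pb l p q = (coef x.1 x.2 p * coef y.1 y.2 q) • pb l (mon x.1 x.2) (mon y.1 y.2) +
      pb l (p - r) s + pb l r q := by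
    have hp : p - r = coef x.1 x.2 p • mon x.1 x.2 := by rw [hr]; abel
    have hq : q = coef y.1 y.2 q • mon y.1 y.2 + s := by rw [hs]; abel
    have h0 : pb l (p - r) (coef y.1 y.2 q • mon y.1 y.2) =
        (coef x.1 x.2 p * coef y.1 y.2 q) • pb l (mon x.1 x.2) (mon y.1 y.2) := by
      rw [hp, pb_smul_left, pb_smul_right, smul_smul]
    rw [← h0, ← pb_add_right, ← hq, ← pb_add_left, sub_add_cancel]
  have hpr : p - r ∈ filt K a b (wt a b x) :=
    Submodule.sub_mem _ hx.mem_filt (filt_mono (by omega) hr')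
  have hw : wt a b (x.1 + y.1 - l, x.2 + y.2 - 1) = wt a b x + wt a b y - (a * l + b) := by
    simp only [wt]
    rw [Nat.cast_sub (by omega : 1 ≤ x.2 + y.2)]; push_cast; ring
  rw [h1, map_add, map_add, coef_eq_zero_of_filt (pb_filt l hpr hs') (by rw [hw]; omega),
    coef_eq_zero_of_filt (pb_filt l hr' hy.mem_filt) (by rw [hw]; omega), pb_mon_mon, map_smul,
    map_smul, coef_mon_self]
  simp

/-- Two independent weights determine an exponent, so on a homogeneous element the maximum of the
second weight is attained only once. -/
theorem exists_isCorner {a b a' b' d : ℤ} (hdet : a * b' - a' * b ≠ 0) {p : LPoly K}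
    (hp : p ≠ 0) (hh : p ∈ homog K a b d) : ∃ x, IsCorner a' b' p x := by
  obtain ⟨x, hx, hmax⟩ := Finset.exists_max_image (exps p) (wt a' b') (exps_nonempty hp)
  refine ⟨x, mem_exps.1 hx, fun i j hij hne => lt_of_le_of_ne (hmax _ (mem_exps.2 hij)) ?_⟩
  intro he
  have h1 := wt_eq_of_homog hh hij
  have h2 := wt_eq_of_homog hh (mem_exps.1 hx)
  rw [← h2] at h1
  simp only [wt] at h1 he
  have e1 : (a * b' - a' * b) * (i - x.1) = 0 := by linear_combination b' * h1 - b * he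
  have e2 : (a * b' - a' * b) * ((j : ℤ) - x.2) = 0 := by linear_combination a * he - a' * h1
  have e3 := (mul_eq_zero.1 e1).resolve_left hdet
  have e4 := (mul_eq_zero.1 e2).resolve_left hdet
  exact hne (Prod.ext (by simp; omega) (by simp; omega))

end LPoly

end Poisson

/-! ### The product of `A₁⁽ˡ⁾` modulo lower weight. -/

section WeylProduct

namespace WeylL

open LPoly OreExtension

variable {K : Type*} [Field K] {l : ℕ}

theorem mulY_apply (q : LPoly K) : mulY (laurentDeriv K l) q = X * q + dX K l q := by
  induction q using Polynomial.induction_on' with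
  | add p q hp hq => rw [map_add, map_add, hp, hq]; ring
  | monomial j b => rw [mulY_monomial, dX_monomial, X_mul_monomial]

theorem X_pow_eq_mon (j : ℕ) : (X ^ j : LPoly K) = mon 0 j := by
  rw [mon, LaurentPolynomial.T_zero, X_pow_eq_monomial]

theorem mon_eq_C_mul_X_pow (i : ℤ) (j : ℕ) :
    (mon i j : LPoly K) = C (LaurentPolynomial.T i) * X ^ j := by
  rw [mon, C_mul_X_pow_eq_monomial]

theorem X_pow_mem_filt (a b : ℤ) (j : ℕ) : (X ^ j : LPoly K) ∈ filt K a b (j * b) := by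
  rw [X_pow_eq_mon]
  refine mon_mem_suppIn ?_
  simp only [Set.mem_ofPred_eq, wt]
  exact le_of_eq (by ring)

/-- In the expansion of `Yʲ q`, each `∂/∂x` falling on `q` replaces one factor `y` and lowers the
weight by `a * l + b`. The terms with at most one derivative are kept. -/
theorem mulY_pow_sub_mem {a b e : ℤ} (hS : 0 ≤ a * l + b) {q : LPoly K} (hq : q ∈ filt K a b e)
    (j : ℕ) : (mulY (laurentDeriv K l) ^ j) q - X ^ j * q - (j : LPoly K) * (X ^ (j - 1) * dX K l q) ∈
      filt K a b (e + j * b - 2 * (a * l + b)) := by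
  induction j with
  | zero => simp
  | succ j ih =>
    obtain ⟨r, hr⟩ : ∃ r, r = (mulY (laurentDeriv K l) ^ j) q - X ^ j * q -
      (j : LPoly K) * (X ^ (j - 1) * dX K l q) := ⟨_, rfl⟩
    rw [← hr] at ih
    have h1 : (mulY (laurentDeriv K l) ^ j) q = X ^ j * q +
        (j : LPoly K) * (X ^ (j - 1) * dX K l q) + r := by rw [hr]; ring
    have h2 : (mulY (laurentDeriv K l) ^ (j + 1)) q - X ^ (j + 1) * q -
        ((j + 1 : ℕ) : LPoly K) * (X ^ (j + 1 - 1) * dX K l q) =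
        X ^ 1 * r + dX K l r + (j : K) • (X ^ (j - 1) * dX K l (dX K l q)) := by
      have hX : ∀ n : ℕ, dX K l (X ^ n : LPoly K) = 0 := fun n => by
        rw [X_pow_eq_mon, dX_mon]; simp
      have hj : (j : LPoly K) * (X ^ (j - 1) * X) = (j : LPoly K) * X ^ j := by
        obtain _ | j := j
        · simp
        · rw [Nat.add_sub_cancel, pow_succ]
      rw [pow_succ', Module.End.mul_apply, h1, mulY_apply]
      simp only [map_add, Derivation.leibniz, hX, smul_eq_mul, Derivation.map_natCast, mul_zero,
        add_zero, Nat.add_sub_cancel, Nat.cast_smul_eq_nsmul, nsmul_eq_mul]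
      push_cast
      linear_combination (dX K l q) * hj
    rw [h2]
    refine Submodule.add_mem _ (Submodule.add_mem _ ?_ ?_) ?_
    · refine filt_mono ?_ (filt_mul (X_pow_mem_filt a b 1) ih)
      push_cast; linarith
    · refine filt_mono ?_ (dX_filt l ih)
      push_cast; linarith
    · obtain _ | j := j
      · simp
      · refine Submodule.smul_mem _ _ (filt_mono ?_ (filt_mul (X_pow_mem_filt a b _) (dX_filt l (dX_filt l hq))))
        rw [Nat.add_sub_cancel]
        push_cast; linarith

theorem leftMul_sub_mem {a b d e : ℤ} (hS : 0 ≤ a * l + b) {p q : LPoly K}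
    (hp : p ∈ filt K a b d) (hq : q ∈ filt K a b e) :
    leftMul (laurentDeriv K l) p q - p * q - dY K p * dX K l q ∈
      filt K a b (d + e - 2 * (a * l + b)) := by
  let φ : LPoly K →ₗ[K] LPoly K := (LinearMap.applyₗ q) ∘ₗ leftMul (laurentDeriv K l) -
    LinearMap.mulRight K q - (LinearMap.mulRight K (dX K l q)) ∘ₗ (dY K : LPoly K →ₗ[K] LPoly K)
  refine (suppIn_le_iff (N := (filt K a b (d + e - 2 * (a * l + b))).comap φ)).2
    (fun i j hij => ?_) hp
  have h1 : φ (mon i j) = C (LaurentPolynomial.T i) * X ^ 0 *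
      ((mulY (laurentDeriv K l) ^ j) q - X ^ j * q -
        (j : LPoly K) * (X ^ (j - 1) * dX K l q)) := by
    change leftMul (laurentDeriv K l) (mon i j) q - mon i j * q - dY K (mon i j) * dX K l q = _
    rw [dY_mon, mon, leftMul_monomial, ← mon, mon_eq_C_mul_X_pow, mon_eq_C_mul_X_pow,
      Nat.cast_smul_eq_nsmul, nsmul_eq_mul]
    ring
  rw [Submodule.mem_comap, h1, ← mon_eq_C_mul_X_pow]
  have h2 : (mon i 0 : LPoly K) ∈ filt K a b (a * i) := mon_mem_suppIn (by simp [wt])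
  refine filt_mono ?_ (filt_mul h2 (mulY_pow_sub_mem hS hq j))
  simp only [Set.mem_ofPred_eq, wt] at hij
  linarith

/-- The product of `A₁⁽ˡ⁾` is compatible with the filtration. -/
theorem psi_mul_mem {a b d e : ℤ} (hS : 0 ≤ a * l + b) {P Q : WeylL K l}
    (hP : weylPsi K l P ∈ filt K a b d) (hQ : weylPsi K l Q ∈ filt K a b e) :
    weylPsi K l (P * Q) ∈ filt K a b (d + e) := by
  have h1 := leftMul_sub_mem (l := l) hS hP hQ
  have h2 := filt_mono (by linarith : d - b + (e - a * l) ≤ d + e)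
    (filt_mul (dY_filt hP) (dX_filt l hQ))
  have h3 := Submodule.add_mem _ (Submodule.add_mem _ (filt_mono (by linarith) h1) h2)
    (filt_mul hP hQ)
  convert h3 using 1
  change leftMul (laurentDeriv K l) (weylPsi K l P) (weylPsi K l Q) = _
  ring

/-- The commutator is the Poisson bracket up to terms of lower weight. -/
theorem psi_commutator_sub_mem {a b d e : ℤ} (hS : 0 ≤ a * l + b) {P Q : WeylL K l}
    (hP : weylPsi K l P ∈ filt K a b d) (hQ : weylPsi K l Q ∈ filt K a b e) :
    weylPsi K l (P * Q - Q * P) - pb l (weylPsi K l P) (weylPsi K l Q) ∈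
      filt K a b (d + e - 2 * (a * l + b)) := by
  have h1 := leftMul_sub_mem (l := l) hS hP hQ
  have h2 := leftMul_sub_mem (l := l) hS hQ hP
  rw [add_comm e d] at h2
  convert Submodule.sub_mem _ h1 h2 using 1
  rw [map_sub]
  change leftMul (laurentDeriv K l) (weylPsi K l P) (weylPsi K l Q) -
    leftMul (laurentDeriv K l) (weylPsi K l Q) (weylPsi K l P) - _ = _
  rw [pb]; ring

end WeylL

end WeylProduct

/-! ### Words in `P` and `Q` under the relation `[Q, P] = 1`. -/

section WeylRelation

variable {K A : Type*} [Field K] [Ring A] [Algebra K A]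

/-- The evaluation `∑ aⱼ Yʲ ↦ ∑ aⱼ(P) Qʲ` of normally ordered words. -/
noncomputable def wordEval (P Q : A) : K[X][X] →ₗ[K] A :=
  Polynomial.lsum fun j => LinearMap.mulRight K (Q ^ j) ∘ₗ (aeval (R := K) P).toLinearMap

theorem wordEval_monomial (P Q : A) (j : ℕ) (a : K[X]) :
    wordEval P Q (monomial j a) = aeval P a * Q ^ j := by
  simp [wordEval, Polynomial.lsum_apply, Polynomial.sum_monomial_index]

theorem wordEval_mem {P Q : A} {B : Subalgebra K A} (hP : P ∈ B) (hQ : Q ∈ B) (c : K[X][X]) :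
    wordEval P Q c ∈ B := by
  induction c using Polynomial.induction_on' with
  | add p q hp hq => rw [map_add]; exact B.add_mem hp hq
  | monomial j a =>
    rw [wordEval_monomial]
    refine B.mul_mem ?_ (B.pow_mem hQ j)
    exact (Algebra.adjoin_le (Set.singleton_subset_iff.2 hP)) (aeval_mem_adjoin_singleton K P)

theorem mul_pow_sub_pow_mul {P Q : A} (h : Q * P - P * Q = 1) (j : ℕ) :
    P * Q ^ j - Q ^ j * P = -((j : A) * Q ^ (j - 1)) := by
  induction j with
  | zero => simp
  | succ j ih =>
    have hj : ((j : A) * Q ^ (j - 1)) * Q = j * Q ^ j := by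
      obtain _ | j := j
      · simp
      · rw [Nat.add_sub_cancel, mul_assoc, ← pow_succ]
    have e : P * Q ^ (j + 1) - Q ^ (j + 1) * P =
        (P * Q ^ j - Q ^ j * P) * Q - Q ^ j * (Q * P - P * Q) := by
      rw [pow_succ]; noncomm_ring
    rw [e, ih, h, neg_mul, hj, Nat.add_sub_cancel]; push_cast; noncomm_ring

theorem commutator_wordEval {P Q : A} (h : Q * P - P * Q = 1) (c : K[X][X]) :
    P * wordEval P Q c - wordEval P Q c * P = wordEval P Q (-derivative c) := by
  induction c using Polynomial.induction_on' with
  | add p q hp hq =>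
    rw [map_add, mul_add, add_mul, add_sub_add_comm, hp, hq, ← map_add, map_add derivative]
    congr 1; ring
  | monomial j a =>
    have hc : P * aeval P a = aeval P a * P := by
      have : aeval P (X * a) = aeval P (a * X) := by rw [mul_comm]
      simpa using this
    rw [derivative_monomial, map_neg, wordEval_monomial, wordEval_monomial, ← mul_assoc, hc,
      mul_assoc, mul_assoc, ← mul_sub, mul_pow_sub_pow_mul h, map_mul, map_natCast, mul_neg,
      mul_assoc]

theorem commutator_aeval {P Q : A} (h : Q * P - P * Q = 1) (a : K[X]) :
    Q * aeval P a - aeval P a * Q = aeval P (derivative a) := by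
  induction a using Polynomial.induction_on' with
  | add p q hp hq =>
    rw [map_add, mul_add, add_mul, add_sub_add_comm, hp, hq, map_add, map_add]
  | monomial i c =>
    -- The relation is invariant under `(P, Q) ↦ (Q, -P)`, so the formula for powers of `Q` also
    -- serves for powers of `P`.
    have h' : (-P) * Q - Q * (-P) = 1 := by rw [← h]; noncomm_ring
    have h1 : Q * P ^ i - P ^ i * Q = (i : A) * P ^ (i - 1) := by
      have h2 := mul_pow_sub_pow_mul (P := Q) (Q := -P) h' i
      obtain _ | i := i
      · simp
      rw [Nat.add_sub_cancel] at h2 ⊢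
      rcases Nat.even_or_odd i with hi | hi
      · rw [hi.add_one.neg_pow, hi.neg_pow] at h2
        rw [← neg_inj, ← h2]; noncomm_ring
      · rw [hi.add_one.neg_pow, hi.neg_pow] at h2
        rw [h2]; noncomm_ring
    rw [derivative_monomial, aeval_monomial, aeval_monomial, ← mul_assoc, ← Algebra.commutes c Q,
      mul_assoc, mul_assoc, ← mul_sub, h1, map_mul, map_natCast, mul_assoc]

theorem aeval_ne_zero_of_commutator [CharZero K] [Nontrivial A] {P Q : A}
    (h : Q * P - P * Q = 1) {a : K[X]} (ha : a ≠ 0) : aeval P a ≠ 0 := by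
  induction hn : a.natDegree using Nat.strong_induction_on generalizing a with
  | _ n ih =>
    intro h0
    by_cases hd : derivative a = 0
    · obtain ⟨c, rfl⟩ := natDegree_eq_zero.1 (derivative_eq_zero.1 hd)
      rw [aeval_C, map_eq_zero_iff _ (FaithfulSMul.algebraMap_injective K A)] at h0
      exact ha (by rw [h0, C_0])
    · have hlt : (derivative a).natDegree < n := by
        rw [← hn]; exact natDegree_derivative_lt fun h0 => hd (derivative_eq_zero.2 h0)
      refine ih _ hlt hd rfl ?_
      rw [← commutator_aeval h, h0]; simp

/-- Bracketing with `P` differentiates a word in `Q` up to sign. Descending on the degree reaches a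
nonzero polynomial in `P`, where bracketing with `Q` does the same. -/
theorem wordEval_ne_zero [CharZero K] [Nontrivial A] {P Q : A}
    (h : Q * P - P * Q = 1) {c : K[X][X]} (hc : c ≠ 0) : wordEval P Q c ≠ 0 := by
  induction hn : c.natDegree using Nat.strong_induction_on generalizing c with
  | _ n ih =>
    intro h0
    by_cases hd : derivative c = 0
    · obtain ⟨a, rfl⟩ := natDegree_eq_zero.1 (derivative_eq_zero.1 hd)
      rw [← monomial_zero_left, wordEval_monomial, pow_zero, mul_one] at h0
      exact aeval_ne_zero_of_commutator h (fun ha => hc (by rw [ha, C_0])) h0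
    · have hlt : (derivative c).natDegree < n := by
        rw [← hn]; exact natDegree_derivative_lt fun h0 => hd (derivative_eq_zero.2 h0)
      refine ih _ hlt hd rfl ?_
      have := commutator_wordEval h c
      rw [h0, map_neg] at this
      simpa [eq_comm] using this

/-- The words `∑_{i,j<n} c i j Pⁱ Qʲ`. -/
noncomputable def squareWords (K : Type*) [Field K] (n : ℕ) : (Fin n × Fin n → K) →ₗ[K] K[X][X] :=
  ∑ x : Fin n × Fin n, ((monomial (x.2 : ℕ)).restrictScalars K ∘ₗ monomial (x.1 : ℕ)) ∘ₗ
    LinearMap.proj x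

theorem squareWords_apply (n : ℕ) (c : Fin n × Fin n → K) :
    squareWords K n c = ∑ x : Fin n × Fin n, monomial (x.2 : ℕ) (monomial (x.1 : ℕ) (c x)) := by
  simp [squareWords]

theorem squareWords_ne_zero {n : ℕ} {c : Fin n × Fin n → K} (hc : c ≠ 0) :
    squareWords K n c ≠ 0 := by
  intro h
  refine hc (funext fun y => ?_)
  have h1 : ((squareWords K n c).coeff y.2).coeff y.1 = c y := by
    rw [squareWords_apply, finsetSum_coeff, finsetSum_coeff, Finset.sum_eq_single y]
    · simp
    · rintro x - hne
      rw [coeff_monomial]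
      split_ifs with h2
      · rw [coeff_monomial, if_neg]
        intro h1; exact hne (Prod.ext (Fin.ext h1) (Fin.ext h2))
      · rw [coeff_zero]
    · simp
  rw [← h1, h]; simp

end WeylRelation

/-! ### Leading forms of words and the choice of `g`. -/

section LeadingForm

namespace LPoly

variable {K : Type*} [Field K]

/-- `g` is the leading form of `p`, of weight `e`. -/
structure IsLead (a b : ℤ) (p : LPoly K) (e : ℤ) (g : LPoly K) : Prop where
  ne_zero : g ≠ 0
  homog : g ∈ homog K a b e
  sub_mem : p - g ∈ filt K a b (e - 1)

theorem exists_isLead (a b : ℤ) {p : LPoly K} (hp : p ≠ 0) : ∃ e g, IsLead a b p e g := by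
  obtain ⟨x, hx, hmax⟩ := Finset.exists_max_image (exps p) (wt a b) (exps_nonempty hp)
  obtain ⟨g, hg, r, hr, rfl⟩ := exists_add_suppIn {y | wt a b y = wt a b x} p
  refine ⟨wt a b x, g, ?_, hg, ?_⟩
  · rintro rfl
    rw [zero_add] at hx
    exact mem_exps.1 hx (hr _ _ (fun h => h rfl))
  · rw [add_sub_cancel_left]
    intro i j hij
    by_contra h0
    have hne : wt a b (i, j) ≠ wt a b x := fun h => h0 (hr i j (fun h' => h' h))
    have hg0 : coef i j g = 0 := hg i j hne
    have := hmax (i, j) (mem_exps.2 (by rwa [map_add, hg0, zero_add]))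
    exact hij (by simp only [Set.mem_ofPred_eq]; omega)

theorem IsLead.mem_filt {a b e : ℤ} {p g : LPoly K} (h : IsLead a b p e g) :
    p ∈ filt K a b e := by
  have := Submodule.add_mem _ (filt_mono (by omega) h.sub_mem) (homog_le_filt a b e h.homog)
  rwa [sub_add_cancel] at this

theorem IsLead.coef_eq {a b e : ℤ} {p g : LPoly K} (h : IsLead a b p e g) {i : ℤ} {j : ℕ}
    (hij : wt a b (i, j) = e) : coef i j p = coef i j g := by
  rw [← sub_eq_zero, ← map_sub]
  exact coef_eq_zero_of_filt h.sub_mem (by omega)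

theorem IsLead.le_of_mem_filt {a b e d : ℤ} {p g : LPoly K} (h : IsLead a b p e g)
    (hp : p ∈ filt K a b d) : e ≤ d := by
  by_contra! hlt
  obtain ⟨i, j, hij⟩ := exists_coef_ne_zero h.ne_zero
  have hw := wt_eq_of_homog h.homog hij
  rw [← h.coef_eq hw, coef_eq_zero_of_filt hp (by omega)] at hij
  exact hij rfl

end LPoly

namespace WeylL

open LPoly

variable {K : Type*} [Field K] {l : ℕ}

theorem commutator_sub_pb_mem {a b v e : ℤ} (hS : 0 < a * l + b) {P G : WeylL K l}
    {p g : LPoly K} (hP : IsLead a b (weylPsi K l P) v p)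
    (hG : IsLead a b (weylPsi K l G) e g) :
    weylPsi K l (P * G - G * P) - pb l p g ∈ filt K a b (v + e - (a * l + b) - 1) := by
  have h1 := psi_commutator_sub_mem hS.le hP.mem_filt hG.mem_filt
  have h2 := pb_filt l hP.sub_mem hG.mem_filt
  have h3 := pb_filt l (homog_le_filt _ _ _ hP.homog) hG.sub_mem
  have h4 : pb l (weylPsi K l P) (weylPsi K l G) =
      pb l (weylPsi K l P - p) (weylPsi K l G) + pb l p (weylPsi K l G - g) + pb l p g := by
    rw [add_assoc, ← pb_add_right, sub_add_cancel, ← pb_add_left, sub_add_cancel]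
  have hle := fun {d : ℤ} (h : d ≤ v + e - (a * l + b) - 1) => filt_mono (K := K) (a := a) (b := b) h
  convert Submodule.add_mem _ (hle (by omega) h1) (Submodule.add_mem _
    (hle (by omega) h2) (hle (by omega) h3)) using 1
  rw [h4]; ring

theorem isLead_commutator {a b v e : ℤ} (hS : 0 < a * l + b) {P G : WeylL K l}
    {p g : LPoly K} (hP : IsLead a b (weylPsi K l P) v p)
    (hG : IsLead a b (weylPsi K l G) e g) (hne : pb l p g ≠ 0) :
    IsLead a b (weylPsi K l (P * G - G * P)) (v + e - (a * l + b)) (pb l p g) :=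
  ⟨hne, pb_homog l hP.homog hG.homog, commutator_sub_pb_mem hS hP hG⟩

theorem psi_ne_zero {P : WeylL K l} (hP : P ≠ 0) : weylPsi K l P ≠ 0 :=
  (map_ne_zero_iff _ (weylPsi K l).injective).2 hP

instance : Nontrivial (WeylL K l) := inferInstanceAs (Nontrivial (LPoly K))

theorem psi_one_mem (a b : ℤ) : weylPsi K l 1 ∈ filt K a b 0 := by
  have : weylPsi K l 1 = mon 0 0 := by
    rw [mon, LaurentPolynomial.T_zero]; rfl
  rw [this]
  exact mon_mem_suppIn (by simp [wt])

theorem psi_pow_mem {a b d : ℤ} (hS : 0 ≤ a * l + b) {P : WeylL K l}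
    (hP : weylPsi K l P ∈ filt K a b d) (n : ℕ) : weylPsi K l (P ^ n) ∈ filt K a b (n * d) := by
  induction n with
  | zero => simpa using psi_one_mem a b
  | succ n ih =>
    rw [pow_succ]
    convert psi_mul_mem hS ih hP using 2
    push_cast; ring

theorem psi_squareWords_mem {a b M : ℤ} (hM : 0 ≤ M) (hS : 0 ≤ a * l + b) {P Q : WeylL K l}
    (hP : weylPsi K l P ∈ filt K a b M) (hQ : weylPsi K l Q ∈ filt K a b M) (n : ℕ)
    (c : Fin n × Fin n → K) :
    weylPsi K l (wordEval P Q (squareWords K n c)) ∈ filt K a b (2 * n * M) := by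
  rw [squareWords_apply, map_sum, map_sum]
  refine Submodule.sum_mem _ fun x _ => ?_
  have hx : wordEval P Q (monomial (x.2 : ℕ) (monomial (x.1 : ℕ) (c x))) =
      c x • (P ^ (x.1 : ℕ) * Q ^ (x.2 : ℕ)) := by
    rw [wordEval_monomial, aeval_monomial, Algebra.smul_def, mul_assoc]
  rw [hx, map_smul]
  refine Submodule.smul_mem _ _ (filt_mono ?_
    (psi_mul_mem hS (psi_pow_mem hS hP x.1) (psi_pow_mem hS hQ x.2)))
  have h1 : ((x.1 : ℕ) : ℤ) ≤ n := by exact_mod_cast x.1.2.le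
  have h2 : ((x.2 : ℕ) : ℤ) ≤ n := by exact_mod_cast x.2.2.le
  nlinarith

/-- Some word in `P` and `Q` has a leading form that does not Poisson commute with that of `P`. -/
theorem exists_word_not_commuting [CharZero K] (hl : 0 < l) {a b a' b' v : ℤ}
    (hS : 0 < a * l + b) (hdet : a * b' - a' * b ≠ 0) {P Q : WeylL K l} {p : LPoly K}
    (hPQ : Q * P - P * Q = 1) (hv : 0 < v) (hP : IsLead a b (weylPsi K l P) v p)
    {x : ℤ × ℕ} (hx : IsCorner a' b' p x) (hx2 : 0 < x.2) :
    ∃ (c : K[X][X]) (e : ℤ) (g : LPoly K), IsLead a b (weylPsi K l (wordEval P Q c)) e g ∧ pb l p g ≠ 0 := by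
  have hQ0 : Q ≠ 0 := by rintro rfl; simp at hPQ
  obtain ⟨u, q, hQ⟩ := exists_isLead a b (psi_ne_zero hQ0)
  obtain ⟨M, hM⟩ : ∃ M : ℕ, (M : ℤ) = max v (max u 0) := ⟨_, Int.toNat_of_nonneg (by omega)⟩
  have hPM := filt_mono (by omega : v ≤ M) hP.mem_filt
  have hQM := filt_mono (by omega : u ≤ M) hQ.mem_filt
  -- With this value `n ^ 2 > 2 * n * M + 1`: there are more words than possible corner positions.
  let n := 2 * M + 2
  -- A form of weight `d` commuting with `p` has its corner at `(d / v) • x`; `ψ` reads the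
  -- coefficients there. The integer divisions are exact at the weight that matters, by `h1` and
  -- `h2` below.
  let ψ : (Fin n × Fin n → K) →ₗ[K] (Fin (2 * n * M + 1) → K) :=
    LinearMap.pi fun d => coef ((d : ℤ) * x.1 / v) ((d : ℤ) * x.2 / v).toNat ∘ₗ
      (weylPsi K l).toLinearMap ∘ₗ wordEval P Q ∘ₗ squareWords K n
  have hker : LinearMap.ker ψ ≠ ⊥ := by
    apply LinearMap.ker_ne_bot_of_finrank_lt
    simp only [Module.finrank_fintype_fun_eq_card, Fintype.card_prod, Fintype.card_fin, n]
    nlinarith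
  obtain ⟨c, hc, hc0⟩ := (Submodule.ne_bot_iff _).1 hker
  have hG0 := wordEval_ne_zero hPQ (squareWords_ne_zero hc0)
  obtain ⟨e, g, hg⟩ := exists_isLead a b (psi_ne_zero hG0)
  refine ⟨_, e, g, hg, fun hpg => ?_⟩
  obtain ⟨y, hy⟩ := exists_isCorner hdet hg.ne_zero hg.homog
  have hl' : (l : K) ≠ 0 := Nat.cast_ne_zero.2 hl.ne'
  have hal : x.2 * y.1 - x.1 * y.2 = 0 := by
    have h := coef_pb_corner l hx hy (by omega)
    rw [hpg, map_zero, eq_comm, mul_eq_zero, mul_eq_zero, div_eq_zero_iff] at h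
    have h' : ((x.2 * y.1 - x.1 * y.2 : ℤ) : K) = 0 := by simpa [hx.1, hy.1, hl'] using h
    exact_mod_cast h'
  have hwx : a * x.1 + b * x.2 = v := wt_eq_of_homog hP.homog hx.1
  have hwy : a * y.1 + b * y.2 = e := wt_eq_of_homog hg.homog hy.1
  have h1 : e * x.1 = v * y.1 := by linear_combination x.1 * (-hwy) + y.1 * hwx - b * hal
  have h2 : e * x.2 = v * y.2 := by linear_combination x.2 * (-hwy) + y.2 * hwx + a * hal
  -- This is where `0 < x.2` matters: the ordinate `y.2` cannot be negative, whereas `y.1` could be.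
  have he0 : 0 ≤ e := by
    have : 0 ≤ e * (x.2 : ℤ) := by rw [h2]; positivity
    exact nonneg_of_mul_nonneg_left this (by exact_mod_cast hx2)
  have heN : e ≤ 2 * n * M :=
    hg.le_of_mem_filt (psi_squareWords_mem (by positivity) hS.le hPM hQM n c)
  have hcoef := congrFun (LinearMap.mem_ker.1 hc) ⟨e.toNat, by zify; omega⟩
  simp only [ψ, LinearMap.pi_apply, LinearMap.comp_apply, Pi.zero_apply,
    LinearEquiv.coe_coe, Int.toNat_of_nonneg he0, h1, h2] at hcoef
  rw [Int.mul_ediv_cancel_left _ hv.ne', Int.mul_ediv_cancel_left _ hv.ne', Int.toNat_natCast,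
    hg.coef_eq hwy] at hcoef
  exact hy.1 hcoef

/-- Some word in `P` and `Q` has a leading form `g` with `{p, g} ≠ 0` and `{p, {p, g}} = 0`. -/
theorem exists_word_second_order [CharZero K] {a b v : ℤ}
    (hS : 0 < a * l + b) {P Q : WeylL K l} {p : LPoly K} (hPQ : Q * P - P * Q = 1)
    (hP : IsLead a b (weylPsi K l P) v p) (c : K[X][X])
    (hc : ∃ e g, IsLead a b (weylPsi K l (wordEval P Q c)) e g ∧ pb l p g ≠ 0) :
    ∃ (c' : K[X][X]) (e : ℤ) (g : LPoly K), IsLead a b (weylPsi K l (wordEval P Q c')) e g ∧ pb l p g ≠ 0 ∧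
      IsLead a b (weylPsi K l (wordEval P Q (-derivative c'))) (v + e - (a * l + b)) (pb l p g) ∧
      pb l p (pb l p g) = 0 := by
  induction hn : c.natDegree using Nat.strong_induction_on generalizing c with
  | _ n ih =>
    obtain ⟨e, g, hg, hpg⟩ := hc
    have h1 := isLead_commutator hS hP hg hpg
    rw [commutator_wordEval hPQ] at h1
    by_cases h2 : pb l p (pb l p g) = 0
    · exact ⟨c, e, g, hg, hpg, h1, h2⟩
    -- The word of the commutator has smaller degree in `Q`. A zero derivative is impossible, since
    -- `{p, g}` would then be the leading form of `0`.
    · refine ih _ ?_ (-derivative c) ⟨_, _, h1, h2⟩ rfl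
      rw [natDegree_neg, ← hn]
      refine natDegree_derivative_lt fun h0 => ?_
      rw [derivative_eq_zero.2 h0] at h1
      refine h1.ne_zero (eq_zero_of_homog_of_filt h1.homog (e := v + e - (a * l + b) - 1) ?_ (by omega))
      simpa using Submodule.neg_mem _ h1.sub_mem

end WeylL

end LeadingForm

/-! ### Integrality of `g p / {p, g}`. -/

section Quotient

namespace LPoly

variable {K : Type*} [Field K]

/-- Euler's identity for homogeneous elements. -/
theorem euler {l : ℕ} (hl : (l : K) ≠ 0) {a b v : ℤ} {p : LPoly K} (hp : p ∈ homog K a b v) :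
    (a * l : K) • (mon l 0 * dX K l p) + (b : K) • (mon 0 1 * dY K p) = (v : K) • p := by
  let φ : LPoly K →ₗ[K] LPoly K :=
    (a * l : K) • (LinearMap.mulLeft K (mon l 0) ∘ₗ (dX K l : LPoly K →ₗ[K] LPoly K)) +
      (b : K) • (LinearMap.mulLeft K (mon 0 1) ∘ₗ (dY K : LPoly K →ₗ[K] LPoly K)) -
      (v : K) • LinearMap.id
  rw [← sub_eq_zero]
  refine (suppIn_le_iff (N := LinearMap.ker φ)).2 (fun i j hij => ?_) hp
  change (a * l : K) • (mon l 0 * dX K l (mon i j)) + (b : K) • (mon 0 1 * dY K (mon i j)) -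
    (v : K) • mon i j = 0
  have hY : (mon 0 1 * dY K (mon i j) : LPoly K) = (j : K) • mon i j := by
    rw [dY_mon, mul_smul_comm, mon_mul_mon]
    obtain _ | j := j
    · simp
    · congr 2 <;> omega
  have hX : (mon l 0 * dX K l (mon i j) : LPoly K) = ((i : K) / l) • mon i j := by
    rw [dX_mon, mul_smul_comm, mon_mul_mon]
    congr 2 <;> omega
  have hw : a * i + b * j = v := hij
  rw [hX, hY, smul_smul, smul_smul, ← add_smul, ← sub_smul, ← hw]
  have : (a * l : K) * (i / l) + b * j - ((a * i + b * j : ℤ) : K) = 0 := by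
    push_cast; field_simp; ring
  rw [this, zero_smul]

/-- Euler's identity eliminates `∂/∂x`, leaving a weighted Wronskian in `y`. -/
theorem euler_pb {l : ℕ} (hl : (l : K) ≠ 0) {a b v e : ℤ} {p g : LPoly K}
    (hp : p ∈ homog K a b v) (hg : g ∈ homog K a b e) :
    (a * l : K) • (mon l 0 * pb l p g) = (e : K) • (g * dY K p) - (v : K) • (p * dY K g) := by
  have h1 := euler hl hp
  have h2 := euler hl hg
  simp only [Algebra.smul_def] at *
  rw [pb]
  linear_combination (dY K p) * h2 - (dY K g) * h1

/-- The specialisation `x = 1`. -/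
noncomputable def atOne (K : Type*) [Field K] : LPoly K →ₐ[K] K[X] :=
  Polynomial.mapAlgHom (AddMonoidAlgebra.lift K K ℤ 1)

theorem atOne_mon (i : ℤ) (j : ℕ) : atOne K (mon i j) = X ^ j := by
  rw [atOne, mon, coe_mapAlgHom, map_monomial, LaurentPolynomial.T]
  simp [X_pow_eq_monomial, AddMonoidAlgebra.lift_single, -LaurentPolynomial.single_eq_C_mul_T]

theorem atOne_dY (p : LPoly K) : atOne K (dY K p) = derivative (atOne K p) := by
  rw [atOne, coe_mapAlgHom, dY_apply, derivative_map]

/-- When `a ≠ 0`, the weight and the exponent of `y` determine that of `x`, so setting `x = 1`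
causes no cancellation. -/
theorem atOne_ne_zero {a b v : ℤ} (ha : a ≠ 0) {p : LPoly K} (hp : p ∈ homog K a b v)
    (h0 : p ≠ 0) : atOne K p ≠ 0 := by
  obtain ⟨i, j, hij⟩ := exists_coef_ne_zero h0
  have hw : a * i + b * j = v := wt_eq_of_homog hp hij
  have h1 : (atOne K p).coeff j = coef i j p := by
    conv_lhs => rw [← sum_coef_smul_mon p]
    rw [map_sum, finsetSum_coeff, Finset.sum_eq_single (i, j)]
    · rw [map_smul, atOne_mon, coeff_smul, coeff_X_pow_self, smul_eq_mul, mul_one]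
    · rintro ⟨i', j'⟩ hx hne
      rw [map_smul, atOne_mon, coeff_smul, coeff_X_pow, if_neg, smul_zero]
      rintro rfl
      have hw' : a * i' + b * j = v := wt_eq_of_homog hp (mem_exps.1 hx)
      exact hne (Prod.ext (mul_left_cancel₀ ha (by linarith)) rfl)
    · intro h
      exact absurd (mem_exps.2 hij) h
  intro h
  rw [h, coeff_zero] at h1
  exact hij h1.symm

/-- The inclusion `K[y] ⊆ L`. -/
noncomputable def ofPoly (K : Type*) [Field K] : K[X] →ₐ[K] LPoly K :=
  Polynomial.mapAlgHom (Algebra.ofId K (LaurentPolynomial K))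

theorem ofPoly_X_pow (j : ℕ) : ofPoly K (X ^ j) = mon 0 j := by
  rw [map_pow, ofPoly, coe_mapAlgHom, map_X, mon, LaurentPolynomial.T_zero, X_pow_eq_monomial]

theorem coef_ofPoly (p : K[X]) (j : ℕ) : coef 0 j (ofPoly K p) = p.coeff j := by
  rw [ofPoly, coe_mapAlgHom, coef_apply, coeff_map, RingHom.coe_coe, Algebra.ofId_apply,
    ← LaurentPolynomial.C_eq_algebraMap]
  simp

theorem ofPoly_injective : Function.Injective (ofPoly K) := fun p q h => by
  ext j; rw [← coef_ofPoly, h, coef_ofPoly]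

theorem ofPoly_atOne_mem {a b d : ℤ} {p : LPoly K} (hp : p ∈ homog K a b d) :
    ofPoly K (atOne K p) ∈ suppIn K {x | ∃ i : ℤ, a * i + b * x.2 = d} := by
  refine suppIn_map ((ofPoly K).toLinearMap ∘ₗ (atOne K).toLinearMap) (fun i j hij => ?_) hp
  rw [LinearMap.comp_apply, AlgHom.toLinearMap_apply, AlgHom.toLinearMap_apply, atOne_mon,
    ofPoly_X_pow]
  exact mon_mem_suppIn ⟨i, hij⟩

theorem exists_homog_lift {a b d : ℤ} {q : K[X]}
    (hq : ∀ j, q.coeff j ≠ 0 → ∃ i : ℤ, a * i + b * j = d) :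
    ∃ f ∈ homog K a b d, atOne K f = q := by
  choose! i hi using hq
  refine ⟨∑ j ∈ q.support, q.coeff j • mon (i j) j, Submodule.sum_mem _ fun j hj =>
    Submodule.smul_mem _ _ (mon_mem_suppIn (hi j (mem_support_iff.1 hj))), ?_⟩
  conv_rhs => rw [q.as_sum_support]
  rw [map_sum]
  refine Finset.sum_congr rfl fun j _ => ?_
  rw [map_smul, atOne_mon, smul_eq_C_mul, C_mul_X_pow_eq_monomial]

theorem exists_homog_quotient_of_ne_zero [CharZero K] {l : ℕ} (hl : 0 < l) {a b v e : ℤ}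
    (ha : a ≠ 0) (hS : 0 < a * l + b) (hv : 0 < v) {p g : LPoly K} (hp0 : p ≠ 0)
    (hp : p ∈ homog K a b v) (hg : g ∈ homog K a b e) (hh : pb l p g ≠ 0)
    (hph : pb l p (pb l p g) = 0) :
    ∃ f ∈ homog K a b (a * l + b), pb l p g * f = g * p := by
  have hl' : (l : K) ≠ 0 := Nat.cast_ne_zero.2 hl.ne'
  have hH := pb_homog l hp hg
  have e1 := congrArg (atOne K) (euler_pb hl' hp hg)
  have e2 := congrArg (atOne K) (euler_pb hl' hp hH)
  rw [hph, mul_zero, smul_zero, map_zero, eq_comm, map_sub, sub_eq_zero] at e2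
  simp only [map_sub, map_smul, map_mul, atOne_dY, atOne_mon, pow_zero, one_mul] at e1 e2
  simp only [Algebra.smul_def, map_intCast] at e1 e2
  obtain ⟨q, hq⟩ := dvd_mul_of_wronskian (K := K) (Polynomial.derivative' (R := K))
    (fun _ h => not_dvd_derivative_of_prime h) hv (by omega)
    (atOne_ne_zero ha hp hp0) (atOne_ne_zero ha hH hh) e1 e2
  have hgp : g * p ∈ homog K a b (e + v) := homog_mul hg hp
  -- The quotient in `K[y]` comes from a homogeneous element only if each of its exponents admits an
  -- integral exponent of `x`. This congruence condition is inherited from `h` and `g p`.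
  have hq' : ofPoly K q ∈ suppIn K {x | ∃ i : ℤ, a * i + b * x.2 = a * l + b} := by
    refine mem_suppIn_of_mul_mem ((map_ne_zero_iff _ ofPoly_injective).2 (atOne_ne_zero ha hH hh))
      (ofPoly_atOne_mem hH) (S₂ := {x | ∃ i : ℤ, a * i + b * x.2 = e + v}) ?_ ?_
    · rw [← map_mul, ← hq, ← map_mul]
      exact ofPoly_atOne_mem hgp
    · rintro x ⟨i, hi⟩ y
      constructor
      · rintro ⟨i', hi'⟩
        refine ⟨i' - i, ?_⟩
        rw [Prod.snd_add] at hi'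
        push_cast at hi'
        linarith
      · rintro ⟨i', hi'⟩
        refine ⟨i + i', ?_⟩
        rw [Prod.snd_add]
        push_cast
        linarith
  obtain ⟨f, hf, rfl⟩ := exists_homog_lift (a := a) (b := b) (d := a * l + b) (q := q)
    (fun j hj => by
      by_contra h
      exact hj (by rw [← coef_ofPoly]; exact hq' 0 j h))
  refine ⟨f, hf, ?_⟩
  by_contra hne
  have hhf := homog_mul hH hf
  rw [show v + e - (a * l + b) + (a * l + b) = e + v by ring] at hhf
  refine atOne_ne_zero ha (Submodule.sub_mem _ hhf hgp) (sub_ne_zero.2 hne) ?_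
  rw [map_sub, map_mul, map_mul, hq, sub_self]

theorem exists_eq_monomial {b v : ℤ} (hb : b ≠ 0) {p : LPoly K} (hp0 : p ≠ 0)
    (hp : p ∈ homog K 0 b v) : ∃ (j : ℕ) (c : LaurentPolynomial K), b * j = v ∧ p = monomial j c := by
  obtain ⟨i, j, hij⟩ := exists_coef_ne_zero hp0
  have hw : 0 * i + b * j = v := wt_eq_of_homog hp hij
  refine ⟨j, p.coeff j, by linarith, ext_coef fun i' j' => ?_⟩
  rw [coef_apply, coef_apply, coeff_monomial]
  split_ifs with h
  · rw [h]
  · refine hp i' j' fun hw' => h ?_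
    have hw' : 0 * i' + b * j' = v := hw'
    have : b * (j : ℤ) = b * j' := by linarith
    exact_mod_cast mul_left_cancel₀ hb this

theorem pb_monomial (l : ℕ) (j k : ℕ) (p g : LaurentPolynomial K) :
    pb l (monomial j p) (monomial k g) = monomial (j + k - 1)
      ((j : LaurentPolynomial K) * (p * laurentDeriv K l g) -
        (k : LaurentPolynomial K) * (g * laurentDeriv K l p)) := by
  have h1 : dY K (monomial j p) * dX K l (monomial k g) =
      monomial (j + k - 1) ((j : LaurentPolynomial K) * (p * laurentDeriv K l g)) := by
    rw [dY_monomial, dX_monomial, smul_mul_assoc, monomial_mul_monomial, Nat.cast_smul_eq_nsmul,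
      smul_monomial, nsmul_eq_mul]
    obtain _ | j := j
    · simp
    · congr 2; omega
  have h2 : dX K l (monomial j p) * dY K (monomial k g) =
      monomial (j + k - 1) ((k : LaurentPolynomial K) * (g * laurentDeriv K l p)) := by
    rw [dY_monomial, dX_monomial, mul_smul_comm, monomial_mul_monomial, Nat.cast_smul_eq_nsmul,
      smul_monomial, nsmul_eq_mul, mul_comm g]
    obtain _ | k := k
    · simp
    · congr 2
  rw [pb, h1, h2, ← map_sub]

/-- When `a = 0`, homogeneous elements are a power of `y` times a Laurent polynomial, and the
equations live in the variable `x`. -/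
theorem exists_homog_quotient_of_eq_zero [CharZero K] {l : ℕ} (hl : 0 < l) {b v e : ℤ}
    (hb : 0 < b) (hv : 0 < v) {p g : LPoly K} (hp0 : p ≠ 0)
    (hp : p ∈ homog K 0 b v) (hg : g ∈ homog K 0 b e) (hh : pb l p g ≠ 0)
    (hph : pb l p (pb l p g) = 0) :
    ∃ f ∈ homog K 0 b b, pb l p g * f = g * p := by
  have hg0 : g ≠ 0 := by
    rintro rfl
    exact hh (by simp [pb])
  obtain ⟨j, p, hj, rfl⟩ := exists_eq_monomial hb.ne' hp0 hp
  obtain ⟨k, g, hk, rfl⟩ := exists_eq_monomial hb.ne' hg0 hg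
  have hj0 : (0 : ℤ) < j := by
    rw [← hj] at hv
    exact pos_of_mul_pos_right hv hb.le
  rw [pb_monomial] at hh hph ⊢
  rw [pb_monomial, monomial_eq_zero_iff] at hph
  obtain ⟨h, hdef⟩ : ∃ h, h = (j : LaurentPolynomial K) * (p * laurentDeriv K l g) -
        (k : LaurentPolynomial K) * (g * laurentDeriv K l p) := ⟨_, rfl⟩
  rw [← hdef] at hh hph ⊢
  have hp' : p ≠ 0 := fun h0 => hp0 (by rw [h0, map_zero])
  have hh' : h ≠ 0 := fun h0 => hh (by rw [h0, map_zero])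
  obtain ⟨q, hq⟩ : h ∣ g * p := by
    refine dvd_mul_of_wronskian (K := K) (laurentDeriv K l) (fun _ h => laurentDeriv_prime hl h)
      (α := j) (β := k) (γ := (j + k - 1 : ℕ)) (u := -1) hj0 (by omega) hp' hh' ?_ ?_
    · rw [hdef]; push_cast; ring
    · push_cast
      linear_combination (-1 : LaurentPolynomial K) * hph
  refine ⟨monomial 1 q, ?_, ?_⟩
  · intro i m him
    rw [coef_apply, coeff_monomial, if_neg, AddMonoidAlgebra.coeff_zero]
    · rfl
    · rintro rfl
      exact him (by simp [wt])
  · rw [monomial_mul_monomial, monomial_mul_monomial, hq, show j + k - 1 + 1 = k + j by omega]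

theorem exists_homog_quotient [CharZero K] {l : ℕ} (hl : 0 < l) {a b v e : ℤ}
    (hS : 0 < a * l + b) (hv : 0 < v) {p g : LPoly K} (hp0 : p ≠ 0)
    (hp : p ∈ homog K a b v) (hg : g ∈ homog K a b e) (hh : pb l p g ≠ 0)
    (hph : pb l p (pb l p g) = 0) :
    ∃ f ∈ homog K a b (a * l + b), pb l p g * f = g * p ∧ pb l p f = p := by
  obtain ⟨f, hf, hfe⟩ : ∃ f ∈ homog K a b (a * l + b), pb l p g * f = g * p := by
    by_cases ha : a = 0
    · subst ha
      rw [zero_mul, zero_add] at *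
      exact exists_homog_quotient_of_eq_zero hl hS hv hp0 hp hg hh hph
    · exact exists_homog_quotient_of_ne_zero hl ha hS hv hp0 hp hg hh hph
  refine ⟨f, hf, hfe, mul_left_cancel₀ hh ?_⟩
  -- Applying `{p, ·}` to `h f = g p`, with `{p, h} = 0`, gives `h {p, f} = h p`.
  have h1 := congrArg (pb l p) hfe
  rw [pb_mul_right, pb_mul_right, hph, pb_self, mul_zero, mul_zero, add_zero, zero_add] at h1
  rw [h1, mul_comm]

end LPoly

end Quotient

/-! ### Corners of solutions of `{p, f} = p`. -/

section Corners

namespace LPoly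

variable {K : Type*} [Field K]

theorem corner_dichotomy [CharZero K] {l : ℕ} (hl : 0 < l) {a b a' b' v : ℤ}
    (hS : 0 < a * l + b) (hv : 0 < v) {p f : LPoly K} (hp : p ∈ homog K a b v)
    (hf : f ∈ homog K a b (a * l + b)) (hpf : pb l p f = p) {x y : ℤ × ℕ}
    (hx : IsCorner a' b' p x) (hy : IsCorner a' b' f y) :
    (x.2 * y.1 = x.1 * y.2 ∨ y = ((l : ℤ), 1)) ∧ x.1 ≠ l * x.2 := by
  have hl' : (l : K) ≠ 0 := Nat.cast_ne_zero.2 hl.ne'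
  have hwx : a * x.1 + b * x.2 = v := wt_eq_of_homog hp hx.1
  have hwy : a * y.1 + b * y.2 = a * l + b := wt_eq_of_homog hf hy.1
  have key : x.2 * y.1 - x.1 * y.2 ≠ 0 → y = ((l : ℤ), 1) := by
    intro hD
    have hpos : 0 < x.2 + y.2 := by
      by_contra h0
      have h1 : x.2 = 0 := by omega
      have h2 : y.2 = 0 := by omega
      apply hD; rw [h1, h2]; simp
    have hz := coef_pb_corner l hx hy hpos
    have hz0 : coef (x.1 + y.1 - l) (x.2 + y.2 - 1) p ≠ 0 := by
      rw [← hpf, hz]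
      exact mul_ne_zero (mul_ne_zero hx.1 hy.1) (div_ne_zero (Int.cast_ne_zero.2 hD) hl')
    -- The corner `x` of `p = {p, f}` obeys the weight bound of the bracket. So the exponent
    -- carrying the determinant is at least as heavy as `x`, hence equal to it.
    have h1 : wt a' b' x ≤ wt a' b' x + wt a' b' y - (a' * l + b') := by
      by_contra h
      refine hx.1 ?_
      rw [← hpf]
      exact coef_eq_zero_of_filt (pb_filt l hx.mem_filt hy.mem_filt) (not_le.1 h)
    have h2 : (x.1 + y.1 - l, x.2 + y.2 - 1) = x := by
      by_contra hne
      have h3 := hx.2 _ _ hz0 hne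
      simp only [wt] at h1 h3
      rw [Nat.cast_sub (by omega : 1 ≤ x.2 + y.2)] at h3
      push_cast at h3
      linarith
    have h3 := congrArg Prod.fst h2
    have h4 := congrArg Prod.snd h2
    simp only at h3 h4
    exact Prod.ext (by simp; omega) (by simp; omega)
  have hnot : y = ((l : ℤ), 1) → x.2 * y.1 - x.1 * y.2 ≠ 0 := by
    rintro rfl hD
    have hz := coef_pb_corner l hx hy (by simp)
    rw [hD, hpf] at hz
    simp only [add_sub_cancel_right, Nat.add_sub_cancel, Int.cast_zero, zero_div, mul_zero] at hz
    exact hx.1 hz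
  refine ⟨?_, fun h => ?_⟩
  · by_cases hD : x.2 * y.1 - x.1 * y.2 = 0
    · exact Or.inl (sub_eq_zero.1 hD)
    · exact Or.inr (key hD)
  · have hx2 : (x.2 : ℤ) ≠ 0 := by
      intro h0; rw [h, h0] at hwx; simp at hwx; omega
    -- If `x` were on the diagonal, both alternatives would put `y` at `(l, 1)`: alignment does so
    -- through the weight of `f`. The determinant would then vanish, contradicting `hnot`.
    by_cases hD : x.2 * y.1 - x.1 * y.2 = 0
    · have h1 : y.1 = l * y.2 := by
        rw [h] at hD
        exact mul_left_cancel₀ hx2 (by linear_combination hD)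
      have h2 : (y.2 : ℤ) = 1 := by
        rw [h1] at hwy
        exact mul_left_cancel₀ hS.ne' (by linear_combination hwy)
      exact hnot (Prod.ext (by rw [h1, h2]; simp) (by exact_mod_cast h2)) hD
    · have := key hD
      rw [this] at hD
      apply hD; rw [h]; push_cast; ring

/-- A solution of `{p, f} = p` has no negative powers of `x` if `p` has none. -/
theorem nonneg_of_pb_eq_self [CharZero K] {l : ℕ} (hl : 0 < l) {a b v : ℤ}
    (hS : 0 < a * l + b) (hv : 0 < v) {p f : LPoly K} (hp0 : p ≠ 0) (hp : p ∈ homog K a b v)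
    (hf : f ∈ homog K a b (a * l + b)) (hpf : pb l p f = p)
    (hpos : ∀ i j, coef i j p ≠ 0 → 0 ≤ i) {i : ℤ} {j : ℕ} (hij : coef i j f ≠ 0) : 0 ≤ i := by
  have hf0 : f ≠ 0 := by rintro rfl; simp at hij
  have hwij : a * i + b * j = a * l + b := wt_eq_of_homog hf hij
  -- When `s` has the sign of `b`, the weight `(-s, s * l)` on a homogeneous element is largest at
  -- the smallest exponent of `x`. It suffices to bound that corner, using its alignment with a
  -- corner of `p`.
  have step : ∀ s : ℤ, 0 < s * b → 0 ≤ i := by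
    intro s hs
    have hdet : a * (s * l) - (-s) * b ≠ 0 := by
      have hs0 : s ≠ 0 := by rintro rfl; simp at hs
      have : a * (s * l) - (-s) * b = s * (a * l + b) := by ring
      rw [this]; exact mul_ne_zero hs0 hS.ne'
    obtain ⟨x, hx⟩ := exists_isCorner hdet hp0 hp
    obtain ⟨y, hy⟩ := exists_isCorner hdet hf0 hf
    have hwx : a * x.1 + b * x.2 = v := wt_eq_of_homog hp hx.1
    have hwy : a * y.1 + b * y.2 = a * l + b := wt_eq_of_homog hf hy.1
    have hy0 : 0 ≤ y.1 := by
      rcases (corner_dichotomy hl hS hv hp hf hpf hx hy).1 with h | h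
      · have h1 : v * y.1 = (a * l + b) * x.1 := by
          linear_combination b * h + x.1 * hwy - y.1 * hwx
        have h2 : 0 ≤ v * y.1 := by rw [h1]; exact mul_nonneg hS.le (hpos _ _ hx.1)
        exact nonneg_of_mul_nonneg_right h2 hv
      · rw [h]; simp
    have hle : wt (-s) (s * l) (i, j) ≤ wt (-s) (s * l) y := by
      by_contra hlt
      exact hij (coef_eq_zero_of_filt hy.mem_filt (not_le.1 hlt))
    simp only [wt] at hle
    have h2 : s * (a * l + b) * b * (y.1 - i) ≤ 0 := by
      have h3 : b * (s * (a * l + b) * (y.1 - i)) =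
          b * b * (-s * i + s * l * j - (-s * y.1 + s * l * y.2)) := by
        linear_combination (s * l * b) * hwy - (s * l * b) * hwij
      nlinarith [mul_nonneg (mul_self_nonneg b) (sub_nonneg.2 hle)]
    by_contra! hneg
    have h4 : 0 < (s * b) * ((a * l + b) * (y.1 - i)) :=
      mul_pos hs (mul_pos hS (by omega))
    linarith
  rcases lt_trichotomy b 0 with hb | hb | hb
  · exact step (-1) (by omega)
  · rw [hb] at hwij hS
    simp only [zero_mul, add_zero] at hwij hS
    have ha : a ≠ 0 := by rintro rfl; simp at hS
    rw [mul_left_cancel₀ ha hwij]; positivity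
  · exact step 1 (by omega)

theorem IsLead.mem_suppIn {a b e : ℤ} {p g : LPoly K} (h : IsLead a b p e g)
    {S : Set (ℤ × ℕ)} (hp : p ∈ suppIn K S) : g ∈ suppIn K S := by
  intro i j hij
  by_cases hw : wt a b (i, j) = e
  · rw [← h.coef_eq hw]; exact hp i j hij
  · exact h.homog i j hw

end LPoly

/-! ### Exponents of `A₁` and construction of `f`. -/

namespace WeylL

open LPoly

variable {K : Type*} [Field K] {l : ℕ}

/-- The exponents `(l n, j)` with `n ≥ 0`, which are those occurring in `A₁`. -/
def weylExps (l : ℕ) : Set (ℤ × ℕ) := {x | (l : ℤ) ∣ x.1 ∧ 0 ≤ x.1}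

theorem weylExps_add {x y : ℤ × ℕ} (hx : x ∈ weylExps l) (hy : y ∈ weylExps l) :
    x + y ∈ weylExps l := ⟨dvd_add hx.1 hy.1, add_nonneg hx.2 hy.2⟩

theorem mulY_mem_weylExps {q : LPoly K} (hq : q ∈ suppIn K (weylExps l)) :
    OreExtension.mulY (laurentDeriv K l) q ∈ suppIn K (weylExps l) := by
  rw [mulY_apply]
  refine Submodule.add_mem _ ?_ ?_
  · refine suppIn_mul (fun _ hx _ hy => weylExps_add hx hy) ?_ hq
    rw [← pow_one X, X_pow_eq_mon]
    exact mon_mem_suppIn ⟨dvd_zero _, le_rfl⟩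
  · refine suppIn_map (dX K l : LPoly K →ₗ[K] LPoly K) (fun i j h => ?_) hq
    rw [Derivation.coeFn_coe, dX_mon]
    by_cases hi : i = 0
    · simp [hi]
    · refine Submodule.smul_mem _ _ (mon_mem_suppIn ⟨dvd_sub_self_right.2 h.1, ?_⟩)
      have := Int.le_of_dvd (lt_of_le_of_ne h.2 (Ne.symm hi)) h.1
      simp only; omega

theorem leftMul_mem_weylExps {p q : LPoly K} (hp : p ∈ suppIn K (weylExps l))
    (hq : q ∈ suppIn K (weylExps l)) :
    OreExtension.leftMul (laurentDeriv K l) p q ∈ suppIn K (weylExps l) := by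
  let φ : LPoly K →ₗ[K] LPoly K := (LinearMap.applyₗ q) ∘ₗ OreExtension.leftMul (laurentDeriv K l)
  change φ p ∈ suppIn K (weylExps l)
  refine suppIn_map φ (fun i j hij => ?_) hp
  have h1 : φ (mon i j) = mon i 0 * (OreExtension.mulY (laurentDeriv K l) ^ j) q := by
    change OreExtension.leftMul (laurentDeriv K l) (mon i j) q = _
    rw [mon, OreExtension.leftMul_monomial, mon_eq_C_mul_X_pow, pow_zero, mul_one]
  have h2 : (OreExtension.mulY (laurentDeriv K l) ^ j) q ∈ suppIn K (weylExps l) := by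
    clear hij h1
    induction j with
    | zero => simpa using hq
    | succ j ih =>
      rw [pow_succ', Module.End.mul_apply]
      exact mulY_mem_weylExps ih
  rw [h1]
  exact suppIn_mul (fun _ hx _ hy => weylExps_add hx hy) (mon_mem_suppIn hij) h2

theorem psi_mem_of_mem_weylA1 {P : WeylL K l} (hP : P ∈ weylA1 K l) :
    weylPsi K l P ∈ suppIn K (weylExps l) := by
  induction hP using Algebra.adjoin_induction with
  | mem x hx =>
    rcases hx with rfl | rfl
    · have : weylPsi K l (OreExtension.coef (laurentDeriv K l) (LaurentPolynomial.T (l : ℤ))) = mon l 0 := by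
        rw [mon]; rfl
      rw [this]
      exact mon_mem_suppIn ⟨dvd_rfl, Int.natCast_nonneg l⟩
    · have : weylPsi K l (OreExtension.varY (laurentDeriv K l)) = mon 0 1 := by
        rw [← X_pow_eq_mon, pow_one]; rfl
      rw [this]
      exact mon_mem_suppIn ⟨dvd_zero _, le_rfl⟩
  | algebraMap r =>
    have : weylPsi K l (algebraMap K (WeylL K l) r) = r • mon 0 0 := by
      rw [Algebra.algebraMap_eq_smul_one, map_smul, ← X_pow_eq_mon, pow_zero]; rfl
    rw [this]
    exact Submodule.smul_mem _ _ (mon_mem_suppIn ⟨dvd_zero _, le_rfl⟩)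
  | add x y _ _ hx hy => rw [map_add]; exact Submodule.add_mem _ hx hy
  | mul x y _ _ hx hy =>
    exact leftMul_mem_weylExps hx hy

theorem mem_weylA1_of_psi_mem (hl : 0 < l) {P : WeylL K l} (hP : weylPsi K l P ∈ suppIn K (weylExps l)) :
    P ∈ weylA1 K l := by
  have h := (suppIn_le_iff (N := (Subalgebra.toSubmodule (weylA1 K l)).comap
    (weylPsi K l).symm.toLinearMap)).2 (fun i j hij => ?_) hP
  · simpa using h
  · obtain ⟨⟨n, hn⟩, h0⟩ := hij
    simp only at hn h0
    rw [Submodule.mem_comap, Subalgebra.mem_toSubmodule, LinearEquiv.coe_coe]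
    obtain ⟨m, rfl⟩ : ∃ m : ℕ, n = m := ⟨n.toNat, by
      have : 0 ≤ n := nonneg_of_mul_nonneg_right (hn ▸ h0) (by omega)
      omega⟩
    have h1 : (weylPsi K l).symm (mon i j) =
        OreExtension.coef (laurentDeriv K l) (LaurentPolynomial.T (l : ℤ)) ^ m * OreExtension.varY (laurentDeriv K l) ^ j := by
      have h2 : ∀ m : ℕ, OreExtension.coef (laurentDeriv K l) (LaurentPolynomial.T (l : ℤ)) ^ m =
          OreExtension.coef (laurentDeriv K l) (LaurentPolynomial.T ((l : ℤ) * m)) := by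
        intro m
        induction m with
        | zero => simp only [pow_zero, Nat.cast_zero, mul_zero, LaurentPolynomial.T_zero]; rfl
        | succ m ih =>
          rw [pow_succ, ih, ← OreExtension.coef_mul, ← LaurentPolynomial.T_add]; congr 2
      rw [LinearEquiv.symm_apply_eq, h2, ← hn]
      exact (OreExtension.toPoly_coef_mul_varY_pow _ _ _).symm
    rw [h1]
    refine mul_mem (pow_mem (Algebra.subset_adjoin ?_) _) (pow_mem (Algebra.subset_adjoin ?_) _)
    · exact Or.inl rfl
    · exact Or.inr rfl

/-- The existence of a homogeneous `f` with `{p, f} = p`, where `p` is the leading form of `P`. -/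
theorem exists_pb_eq_self [CharZero K] (hl : 0 < l) {a b v : ℤ} (hS : 0 < a * l + b)
    {P Q : WeylL K l} {p : LPoly K} (hPQ : Q * P - P * Q = 1) (hv : 0 < v)
    (hP : IsLead a b (weylPsi K l P) v p) :
    ∃ f ∈ homog K a b (a * l + b), pb l p f = p ∧
      (P ∈ weylA1 K l → Q ∈ weylA1 K l → f ∈ suppIn K (weylExps l)) := by
  have hl' : (l : K) ≠ 0 := Nat.cast_ne_zero.2 hl.ne'
  -- The counting argument needs a corner of `p` off the `x`-axis.
  by_cases hex : ∃ (a' b' : ℤ) (x : ℤ × ℕ), a * b' - a' * b ≠ 0 ∧ IsCorner a' b' p x ∧ 0 < x.2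
  · obtain ⟨a', b', x, hdet, hx, hx2⟩ := hex
    obtain ⟨c₀, hc₀⟩ := exists_word_not_commuting hl hS hdet hPQ hv hP hx hx2
    obtain ⟨c, e, g, hg, hpg, hh, hph⟩ := exists_word_second_order hS hPQ hP c₀ hc₀
    obtain ⟨f, hf, hfe, hpf⟩ :=
      exists_homog_quotient hl hS hv hP.ne_zero hP.homog hg.homog hpg hph
    refine ⟨f, hf, hpf, fun hPA hQA => ?_⟩
    have hp' := hP.mem_suppIn (psi_mem_of_mem_weylA1 hPA)
    have hg' := hg.mem_suppIn (psi_mem_of_mem_weylA1 (wordEval_mem hPA hQA c))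
    have hh' := hh.mem_suppIn (psi_mem_of_mem_weylA1 (wordEval_mem hPA hQA _))
    -- Divisibility of exponents by `l` passes to the quotient `g p / h`; nonnegativity does not,
    -- and comes from `nonneg_of_pb_eq_self`.
    have hdvd : f ∈ suppIn K {x : ℤ × ℕ | (l : ℤ) ∣ x.1} := by
      refine mem_suppIn_of_mul_mem hpg (suppIn_mono (fun x hx => hx.1) hh')
        (S₂ := {x : ℤ × ℕ | (l : ℤ) ∣ x.1}) ?_ (fun x hx y => ?_)
      · rw [hfe]
        exact suppIn_mono (fun x hx => hx.1)
          (suppIn_mul (fun _ hx _ hy => weylExps_add hx hy) hg' hp')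
      · exact Int.dvd_add_right hx
    intro i j hij
    by_contra h0
    refine hij ⟨by by_contra hd; exact h0 (hdvd i j hd), ?_⟩
    refine nonneg_of_pb_eq_self hl hS hv hP.ne_zero hP.homog hf hpf (fun i' j' h => ?_) h0
    by_contra hneg
    exact h (hp' i' j' fun hm => hneg hm.2)
  · push Not at hex
    have hd1 : a * (-l) - 1 * b ≠ 0 := by intro h; linarith
    have hd2 : a * l - (-1) * b ≠ 0 := by intro h; linarith
    obtain ⟨x, hx⟩ := exists_isCorner hd1 hP.ne_zero hP.homog
    obtain ⟨y, hy⟩ := exists_isCorner hd2 hP.ne_zero hP.homog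
    have hx2 : x.2 = 0 := by have := hex _ _ _ hd1 hx; omega
    have hy2 : y.2 = 0 := by have := hex _ _ _ hd2 hy; omega
    have hwx : a * x.1 + b * x.2 = v := wt_eq_of_homog hP.homog hx.1
    have hwy : a * y.1 + b * y.2 = v := wt_eq_of_homog hP.homog hy.1
    rw [hx2, Nat.cast_zero, mul_zero, add_zero] at hwx
    rw [hy2, Nat.cast_zero, mul_zero, add_zero] at hwy
    have ha : a ≠ 0 := by rintro rfl; simp at hwx; omega
    have hx0 : x.1 ≠ 0 := by intro h; rw [h] at hwx; simp at hwx; omega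
    -- The corners for two opposite weights coincide, so `p` is a single monomial in `x`.
    have hxy : x = y := Prod.ext (mul_left_cancel₀ ha (hwx.trans hwy.symm)) (hx2.trans hy2.symm)
    have hpx : p = coef x.1 x.2 p • mon x.1 x.2 := by
      refine ext_coef fun i j => ?_
      rw [map_smul, coef_mon]
      by_cases hne : (i, j) = x
      · subst hne; simp
      · rw [if_neg (by rintro ⟨h1, h2⟩; exact hne (Prod.ext h1.symm h2.symm)), smul_zero]
        by_contra h0
        have h1 := hx.2 i j h0 hne
        have h2 := hy.2 i j h0 (hxy ▸ hne)
        rw [← hxy] at h2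
        simp only [wt] at h1 h2
        linarith
    have hxK : (x.1 : K) ≠ 0 := Int.cast_ne_zero.2 hx0
    refine ⟨(-(l / x.1) : K) • mon l 1, Submodule.smul_mem _ _ (mon_mem_suppIn (by simp [wt])), ?_,
      fun _ _ => Submodule.smul_mem _ _ (mon_mem_suppIn ⟨dvd_rfl, Int.natCast_nonneg l⟩)⟩
    conv_lhs => rw [hpx]
    conv_rhs => rw [hpx]
    rw [pb_smul_left, pb_smul_right, pb_mon_mon, hx2, smul_smul, smul_smul, add_sub_cancel_right]
    congr 1
    push_cast
    field_simp
    ring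

end WeylL

end Corners

/-! ### Rational degrees and end points in terms of integer weights. -/

section LeadingTerms

namespace LPoly

variable {K : Type*} [Field K] {l : ℕ}

theorem supp_eq_image (p : LPoly K) : supp l p = (exps p).image fun x => pt l x.1 x.2 := by
  ext z
  simp only [supp, exps, Finset.mem_biUnion, Finset.mem_image]
  constructor
  · rintro ⟨j, hj, i, hi, rfl⟩
    exact ⟨(i, j), ⟨j, hj, i, hi, rfl⟩, rfl⟩
  · rintro ⟨_, ⟨j, hj, i, hi, rfl⟩, rfl⟩
    exact ⟨j, hj, i, hi, rfl⟩

theorem pointDeg_pt (hl : 0 < l) (ρ σ : ℤ) (i : ℤ) (j : ℕ) :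
    pointDeg ρ σ (pt l i j) = (wt ρ (l * σ) (i, j) : ℚ) / l := by
  have : (l : ℚ) ≠ 0 := Nat.cast_ne_zero.2 hl.ne'
  simp only [pointDeg, pt, wt]
  push_cast
  field_simp

theorem IsLead.deg_eq (hl : 0 < l) {ρ σ v : ℤ} {p g : LPoly K} (h : IsLead ρ (l * σ) p v g) :
    deg l ρ σ p = ((v / l : ℚ) : WithBot ℚ) := by
  have hl' : (0 : ℚ) < l := Nat.cast_pos.2 hl
  rw [deg, supp_eq_image, Finset.image_image]
  apply le_antisymm
  · refine Finset.max_le fun z hz => ?_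
    obtain ⟨⟨i, j⟩, hx, rfl⟩ := Finset.mem_image.1 hz
    rw [WithBot.coe_le_coe, Function.comp_apply, pointDeg_pt hl, div_le_div_iff_of_pos_right hl',
      Int.cast_le]
    by_contra hlt
    exact mem_exps.1 hx (coef_eq_zero_of_filt h.mem_filt (not_le.1 hlt))
  · obtain ⟨i, j, hij⟩ := exists_coef_ne_zero h.ne_zero
    have hw := wt_eq_of_homog h.homog hij
    refine Finset.le_max (Finset.mem_image.2 ⟨(i, j), mem_exps.2 ?_, ?_⟩)
    · rwa [h.coef_eq hw]
    · rw [Function.comp_apply, pointDeg_pt hl, hw]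

theorem coef_lead (ρ σ : ℤ) (p : LPoly K) (i : ℤ) (j : ℕ)
    [Decidable (((pointDeg ρ σ (pt l i j) : ℚ) : WithBot ℚ) = deg l ρ σ p)] :
    coef i j (lead l ρ σ p) =
      if ((pointDeg ρ σ (pt l i j) : ℚ) : WithBot ℚ) = deg l ρ σ p then coef i j p else 0 := by
  classical
  rw [coef_apply, lead, finsetSum_coeff]
  simp only [coeff_monomial]
  rw [Finset.sum_ite_eq' p.support j]
  by_cases hj : j ∈ p.support
  · rw [if_pos hj, AddMonoidAlgebra.coeff_ofCoeff, Finsupp.filter_apply, coef_apply]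
    congr
  · rw [if_neg hj, coef_apply, notMem_support_iff.1 hj]
    simp

theorem IsLead.lead_eq (hl : 0 < l) {ρ σ v : ℤ} {p g : LPoly K} (h : IsLead ρ (l * σ) p v g) :
    lead l ρ σ p = g := by
  classical
  have hl' : (l : ℚ) ≠ 0 := Nat.cast_ne_zero.2 hl.ne'
  refine ext_coef fun i j => ?_
  have hiff : ((pointDeg ρ σ (pt l i j) : ℚ) : WithBot ℚ) = deg l ρ σ p ↔
      wt ρ (l * σ) (i, j) = v := by
    rw [h.deg_eq hl, pointDeg_pt hl, WithBot.coe_inj, div_left_inj' hl', Int.cast_inj]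
  rw [coef_lead, if_congr hiff rfl rfl]
  split_ifs with hw
  · exact h.coef_eq hw
  · exact (h.homog i j hw).symm

theorem isLead_of_homog {a b v : ℤ} {p : LPoly K} (h0 : p ≠ 0) (hp : p ∈ homog K a b v) :
    IsLead a b p v p :=
  ⟨h0, hp, by rw [sub_self]; exact Submodule.zero_mem _⟩

theorem IsCorner.isLead {a b : ℤ} {p : LPoly K} {x : ℤ × ℕ} (h : IsCorner a b p x) :
    IsLead a b p (wt a b x) (coef x.1 x.2 p • mon x.1 x.2) := by
  refine ⟨fun h0 => h.1 ?_, Submodule.smul_mem _ _ (mon_mem_suppIn rfl), h.sub_mem⟩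
  have := congrArg (coef x.1 x.2) h0
  rwa [map_smul, coef_mon_self, smul_eq_mul, mul_one, map_zero] at this

theorem supp_smul_mon {c : K} (hc : c ≠ 0) (x : ℤ × ℕ) :
    supp l (c • mon x.1 x.2 : LPoly K) = {pt l x.1 x.2} := by
  have : exps (c • mon x.1 x.2 : LPoly K) = {x} := by
    ext ⟨i, j⟩
    rw [mem_exps, map_smul, coef_mon, Finset.mem_singleton]
    by_cases h : x.1 = i ∧ x.2 = j
    · rw [if_pos h, smul_eq_mul, mul_one]
      exact iff_of_true hc (Prod.ext h.1.symm h.2.symm)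
    · rw [if_neg h, smul_zero]
      refine iff_of_false (fun h => h rfl) fun he => h ?_
      rw [← he]; exact ⟨rfl, rfl⟩
  rw [supp_eq_image, this, Finset.image_singleton]

/-- At a corner the leading term is one monomial, so the maximum in `w` is over one point and the
default `0` of `unbotD` is never used. -/
theorem IsCorner.w_eq (hl : 0 < l) {p : LPoly K} {x : ℤ × ℕ}
    (h : IsCorner 1 (l * (-1)) p x) : w l p = pt l x.1 x.2 := by
  have hl' : (l : ℚ) ≠ 0 := Nat.cast_ne_zero.2 hl.ne'
  rw [w, h.isLead.lead_eq hl, h.isLead.deg_eq hl, supp_smul_mon h.1, Finset.image_singleton,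
    Finset.max_singleton]
  refine Prod.ext rfl ?_
  simp only [WithBot.unbotD_coe, pt, wt]
  push_cast
  field_simp
  ring

theorem IsCorner.wBar_eq (hl : 0 < l) {p : LPoly K} {x : ℤ × ℕ}
    (h : IsCorner (-1) (l * 1) p x) : wBar l p = pt l x.1 x.2 := by
  have hl' : (l : ℚ) ≠ 0 := Nat.cast_ne_zero.2 hl.ne'
  rw [wBar, h.isLead.lead_eq hl, h.isLead.deg_eq hl, supp_smul_mon h.1, Finset.image_singleton,
    Finset.max_singleton]
  refine Prod.ext ?_ rfl
  simp only [WithBot.unbotD_coe, pt, wt]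
  push_cast
  field_simp
  ring

theorem aligned_pt (hl : 0 < l) {x y : ℤ × ℕ} (h : (x.2 : ℤ) * y.1 = x.1 * y.2) :
    Aligned (pt l x.1 x.2) (pt l y.1 y.2) := by
  have hl' : (l : ℚ) ≠ 0 := Nat.cast_ne_zero.2 hl.ne'
  have h' : (x.2 : ℚ) * y.1 = x.1 * y.2 := by exact_mod_cast h
  simp only [Aligned, pt]
  field_simp
  linarith

theorem pt_eq_one (hl : 0 < l) : pt l (l : ℤ) 1 = (1, 1) := by
  have hl' : (l : ℚ) ≠ 0 := Nat.cast_ne_zero.2 hl.ne'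
  simp [pt, hl']

theorem eq_of_aligned_pt_one (hl : 0 < l) {x : ℤ × ℕ}
    (h : (pt l x.1 x.2).1 = (pt l x.1 x.2).2) : x.1 = l * x.2 := by
  have hl' : (l : ℚ) ≠ 0 := Nat.cast_ne_zero.2 hl.ne'
  simp only [pt] at h
  rw [div_eq_iff hl'] at h
  rw [mul_comm]
  exact_mod_cast h

end LPoly

end LeadingTerms

/-! ### Assembly of the theorem. -/

theorem mainTheorem2 {K : Type*} [Field K] [CharZero K] (l : ℕ) (hl : 0 < l)
    (ρ σ : ℤ) (hdir : IsDirection ρ σ) (P Q : WeylL K l)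
    (hv : 0 < WeylL.deg ρ σ P) (hPQ : Q * P - P * Q = 1) :
    (∃ F : WeylL K l,
      WeylL.IsHomog ρ σ F ∧
      WeylL.deg ρ σ F = (((ρ : ℚ) + (σ : ℚ) : ℚ) : WithBot ℚ) ∧
      WeylL.bracket ρ σ P F = WeylL.lead ρ σ P ∧
      (Aligned (WeylL.st ρ σ P) (WeylL.st ρ σ F) ∨ WeylL.st ρ σ F = (1, 1)) ∧
      (Aligned (WeylL.en ρ σ P) (WeylL.en ρ σ F) ∨ WeylL.en ρ σ F = (1, 1)) ∧
      (P ∈ weylA1 K l → Q ∈ weylA1 K l → F ∈ weylA1 K l)) ∧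
    ¬ Aligned (WeylL.st ρ σ P) (1, 1) ∧
    ¬ Aligned (1, 1) (WeylL.en ρ σ P) := by
  have hlQ : (0 : ℚ) < l := Nat.cast_pos.2 hl
  have hS : 0 < ρ * l + l * σ := by
    have : ρ * l + l * σ = l * (ρ + σ) := by ring
    rw [this]; exact mul_pos (by exact_mod_cast hl) hdir.2
  have hP0 : P ≠ 0 := by rintro rfl; simp at hPQ
  obtain ⟨v, p, hP⟩ := LPoly.exists_isLead ρ (l * σ) (WeylL.psi_ne_zero hP0)
  have hdegP : WeylL.deg ρ σ P = ((v / l : ℚ) : WithBot ℚ) := hP.deg_eq hl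
  have hv' : 0 < v := by
    rw [hdegP, ← WithBot.coe_zero, WithBot.coe_lt_coe] at hv
    have := (div_pos_iff_of_pos_right hlQ).1 hv
    exact_mod_cast this
  obtain ⟨f, hf, hpf, hfA⟩ := WeylL.exists_pb_eq_self hl hS hPQ hv' hP
  have hf0 : f ≠ 0 := by rintro rfl; exact hP.ne_zero (by rw [← hpf]; simp [LPoly.pb])
  obtain ⟨F, rfl⟩ := (weylPsi K l).surjective f
  have hF := LPoly.isLead_of_homog hf0 hf
  have hdegF : WeylL.deg ρ σ F = (((ρ : ℚ) + (σ : ℚ) : ℚ) : WithBot ℚ) := by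
    rw [WeylL.deg, hF.deg_eq hl, WithBot.coe_inj]
    push_cast
    field_simp
  have hPF := WeylL.isLead_commutator hS hP hF (by rw [hpf]; exact hP.ne_zero)
  rw [hpf, add_sub_cancel_right] at hPF
  have hleadP : WeylL.lead ρ σ P = p := hP.lead_eq hl
  have hleadF : WeylL.lead ρ σ F = weylPsi K l F := hF.lead_eq hl
  -- The weights `(1, -l)` and `(-1, l)` single out the start and end points. Their determinants
  -- with `(ρ, l * σ)` are `∓ l(ρ+σ)`.
  have hd1 : ρ * (l * (-1)) - 1 * (l * σ) ≠ 0 := by intro h; linarith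
  have hd2 : ρ * (l * 1) - (-1) * (l * σ) ≠ 0 := by intro h; linarith
  obtain ⟨x, hx⟩ := LPoly.exists_isCorner hd1 hP.ne_zero hP.homog
  obtain ⟨y, hy⟩ := LPoly.exists_isCorner hd1 hf0 hf
  obtain ⟨x', hx'⟩ := LPoly.exists_isCorner hd2 hP.ne_zero hP.homog
  obtain ⟨y', hy'⟩ := LPoly.exists_isCorner hd2 hf0 hf
  obtain ⟨c1, c2⟩ := LPoly.corner_dichotomy hl hS hv' hP.homog hf hpf hx hy
  obtain ⟨c3, c4⟩ := LPoly.corner_dichotomy hl hS hv' hP.homog hf hpf hx' hy'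
  have hstP : WeylL.st ρ σ P = LPoly.pt l x.1 x.2 := by rw [WeylL.st, hleadP, hx.w_eq hl]
  have hstF : WeylL.st ρ σ F = LPoly.pt l y.1 y.2 := by rw [WeylL.st, hleadF, hy.w_eq hl]
  have henP : WeylL.en ρ σ P = LPoly.pt l x'.1 x'.2 := by rw [WeylL.en, hleadP, hx'.wBar_eq hl]
  have henF : WeylL.en ρ σ F = LPoly.pt l y'.1 y'.2 := by rw [WeylL.en, hleadF, hy'.wBar_eq hl]
  refine ⟨⟨F, Or.inr hleadF.symm, hdegF, ?_, ?_, ?_, fun hPA hQA =>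
    WeylL.mem_weylA1_of_psi_mem hl (hfA hPA hQA)⟩, ?_, ?_⟩
  · rw [WeylL.bracket, if_neg, hleadP]
    · exact hPF.lead_eq hl
    -- The commutator has the degree of `P`, which equals `v(P) + v(F) - (ρ + σ)`, so the strict
    -- inequality fails.
    · rw [WeylL.Proportional, hdegP, hdegF, WeylL.deg, hPF.deg_eq hl, ← WithBot.coe_add,
        ← WithBot.coe_add, WithBot.coe_lt_coe, not_lt]
      exact le_of_eq (by ring)
  · rw [hstP, hstF]
    exact c1.imp (LPoly.aligned_pt hl) fun h => by rw [h]; exact LPoly.pt_eq_one hl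
  · rw [henP, henF]
    exact c3.imp (LPoly.aligned_pt hl) fun h => by rw [h]; exact LPoly.pt_eq_one hl
  · rw [hstP]
    intro h
    refine c2 (LPoly.eq_of_aligned_pt_one hl ?_)
    simp only [Aligned, mul_one] at h
    exact sub_eq_zero.1 h
  · rw [henP]
    intro h
    refine c4 (LPoly.eq_of_aligned_pt_one hl ?_)
    simp only [Aligned, one_mul] at h
    exact (sub_eq_zero.1 h).symm
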